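/- \textbf{Setting.} Let $M$ be a closed (compact, boundaryless) smooth Riemannian manifold of dimension $d$, and let $B(y,r)$ denote the open ball of radius $r$ around $y$ for the Riemannian distance (which is infinite between different components). Let $0<\alpha\le 1$, and let $\mathrm{Diff}^{1+\alpha}_{\rm loc}(M)$ be the set of diffeomorphisms $f:\mathrm{Dom}(f)\to\mathrm{Im}(f)$ between open subsets of $M$ such that $f$ and $f^{-1}$ are $\mathcal C^1$ with locally $\alpha$-H\"older derivative. For a linear map $D$ between Euclidean spaces let $\|D\|$ be its operator norm and $m(D)=\inf\{|Dv| : |v|=1\}$ its co-norm; derivatives $D_yf$ are measured in the Riemannian norms of the tangent spaces. For a map $g$ on a set $S\subseteq\mathbb R^d$ put \[\|g\|_{\mathcal C^{1+\alpha}(S)}=\sup_{S}|g|+\sup_{y\in S}\|D_yg\|+\sup\Big\{\tfrac{\|D_yg-D_zg\|}{|y-z|^{\alpha}} : y,z\in S,\ 0<|y-z|<1\Big\}.\] Fix finitely many smooth charts $\varphi_k$ of $M$ and compact sets $K_k$ contained in their domains whose interiors cover $M$. The $\mathcal C^{1+\alpha}$ norm of $f\in\mathrm{Diff}^{1+\alpha}_{\rm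 loc}(M)$ is the largest of the norms $\|\varphi_l\circ f\circ\varphi_k^{-1}\|_{\mathcal C^{1+\alpha}(S_{k,l})}$, where $S_{k,l}=\varphi_k\big(K_k\cap\mathrm{Dom}(f)\cap f^{-1}(K_l)\big)$. \textbf{Theorem.} Let $\{f_i\}_{i=1}^\infty$ be a sequence in $\mathrm{Diff}^{1+\alpha}_{\rm loc}(M)$ whose $\mathcal C^{1+\alpha}$ norms are bounded by a common constant. Write $f^n=f_n\circ\cdots\circ f_1$, with its natural domain, and $f^0=\mathrm{Id}$. Let $x\in M$ and $\rho>0$ be such that $B(f^{n-1}(x),\rho)\subseteq\mathrm{Dom}(f_n)$ for every $n\ge1$. Suppose that the sequence is expanding at $x$, i.e. there is $\eta>1$ with $m(D_{f^{n-1}(x)}f_n)>\eta$ for all $n\ge 1$, and quasi-conformal at $x$, i.e. there is $\kappa\ge1$ with $\|D_xf^n\|/m(D_xf^n)\le\kappa$ for all $n\ge1$. Then there exist $\xi_0>0$ and $\theta>1$ such that for every $\xi\in(0,\xi_0]$ and every $n\ge0$ there is $r_n>0$ (depending on $\xi$ and $n$) such that $B(x,\theta r_n)\subseteq\mathrm{Dom}(f^n)$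 and \[f^n(B(x,r_n))\subseteq B(f^n(x),\xi)\subseteq f^n(B(x,\theta r_n)).\] -/

import Mathlib

open Set Manifold Bundle Topology
open scoped ContDiff NNReal ENNReal

noncomputable section

namespace ControlGeometry

section LinearMaps

variable {V W : Type*} [NormedAddCommGroup V] [NormedSpace ℝ V]
  [NormedAddCommGroup W] [NormedSpace ℝ W]

/-- The co-norm `m(D) = inf {|D v| : |v| = 1}` of a linear map. -/
def conorm (D : V →L[ℝ] W) : ℝ := sInf {t : ℝ | ∃ v : V, ‖v‖ = 1 ∧ t = ‖D v‖}

/-- `D` is `κ`-conformal if `‖D‖ / m(D) ≤ κ`. Used for invertible maps only, for which `m(D) > 0`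
when the dimension is positive. -/
def IsConformalWith (κ : ℝ) (D : V →L[ℝ] W) : Prop := ‖D‖ ≤ κ * conorm D

end LinearMaps

section Manifold

variable {d : ℕ} {M : Type*} [TopologicalSpace M] [ChartedSpace (EuclideanSpace ℝ (Fin d)) M]

/-- `f` is of class `C^{1+α}` on `U`: it is `C^1` and, read in charts, its derivative is locally
`α`-Hölder. -/
def IsCOneHolderOn (d : ℕ) {M : Type*} [TopologicalSpace M]
    [ChartedSpace (EuclideanSpace ℝ (Fin d)) M] (α : ℝ≥0) (f : M → M) (U : Set M) : Prop :=
  ContMDiffOn (𝓡 d) (𝓡 d) 1 f U ∧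
    ∀ x ∈ U, ∃ C : ℝ≥0, ∃ t ∈ 𝓝 (extChartAt (𝓡 d) x x),
      HolderOnWith C α (fderiv ℝ (writtenInExtChartAt (𝓡 d) (𝓡 d) x f)) t

/-- The space of `C^{1+α}` diffeomorphisms `f : Dom f → Im f` between open subsets of `M`.
Here `source` is `Dom f` and `target` is `Im f`; values of the underlying total function outside
`source` play no role. -/
structure LocDiffeo (d : ℕ) (M : Type*) [TopologicalSpace M]
    [ChartedSpace (EuclideanSpace ℝ (Fin d)) M] (α : ℝ≥0) extends OpenPartialHomeomorph M M where
  isCOneHolderOn_toFun : IsCOneHolderOn d α toFun source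
  isCOneHolderOn_invFun : IsCOneHolderOn d α invFun target

/-- The composition `f^n = f_n ∘ ⋯ ∘ f_1` with its natural domain; `f 0, f 1, …` are the maps
`f_1, f_2, …`, so that `seqComp f 0 = id`. -/
def seqComp {α : ℝ≥0} (f : ℕ → LocDiffeo d M α) : ℕ → OpenPartialHomeomorph M M
  | 0 => OpenPartialHomeomorph.refl M
  | n + 1 => (seqComp f n).trans (f n).toOpenPartialHomeomorph

/-- A finite system of smooth charts `chart k` of `M`, with compact sets `piece k` inside the chart
domains whose interiors cover `M`. It serves to measure the size of maps in coordinates. -/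
structure ChartSystem (d : ℕ) (M : Type*) [TopologicalSpace M]
    [ChartedSpace (EuclideanSpace ℝ (Fin d)) M] where
  card : ℕ
  chart : Fin card → OpenPartialHomeomorph M (EuclideanSpace ℝ (Fin d))
  piece : Fin card → Set M
  chart_mem : ∀ k, chart k ∈ IsManifold.maximalAtlas (𝓡 d) ∞ M
  isCompact_piece : ∀ k, IsCompact (piece k)
  piece_subset : ∀ k, piece k ⊆ (chart k).source
  cover : ⋃ k, interior (piece k) = univ

/-- The `C^{1+α}` norm on a set `S` of Euclidean space:
`sup |g| + sup ‖Dg‖ + sup {‖D_x g - D_y g‖ / |x - y|^α : 0 < |x - y| < 1}`. -/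
def eucNorm (α : ℝ≥0) (g : EuclideanSpace ℝ (Fin d) → EuclideanSpace ℝ (Fin d))
    (S : Set (EuclideanSpace ℝ (Fin d))) : ℝ≥0∞ :=
  (⨆ y ∈ S, ‖g y‖ₑ) + (⨆ y ∈ S, ‖fderiv ℝ g y‖ₑ) +
    ⨆ y ∈ S, ⨆ z ∈ S, ⨆ _ : 0 < ‖y - z‖ ∧ ‖y - z‖ < 1,
      ENNReal.ofReal (‖fderiv ℝ g y - fderiv ℝ g z‖ / ‖y - z‖ ^ (α : ℝ))

/-- The `C^{1+α}` norm of a local diffeomorphism, in a system of charts: the largest `C^{1+α}` norm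
of the coordinate expressions of `f`, each on the part of `Dom f` in one piece that `f` maps to
another piece. -/
def cOneHolderNorm (𝒜 : ChartSystem d M) {α : ℝ≥0} (f : LocDiffeo d M α) : ℝ≥0∞ :=
  ⨆ k, ⨆ l, eucNorm α
    (fun y => 𝒜.chart l (f.toOpenPartialHomeomorph ((𝒜.chart k).symm y)))
    (𝒜.chart k '' (𝒜.piece k ∩ f.source ∩ f.toOpenPartialHomeomorph ⁻¹' 𝒜.piece l))

/-- The sequence `f` has bounded `C^{1+α}` norm. -/
def HasBoundedNorm (𝒜 : ChartSystem d M) {α : ℝ≥0} (f : ℕ → LocDiffeo d M α) : Prop :=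
  ∃ C : ℝ≥0, ∀ i, cOneHolderNorm 𝒜 (f i) ≤ C

variable [RiemannianBundle (fun x : M => TangentSpace (𝓡 d) x)]

/-- The sequence is `η`-expanding at `x` for some `η > 1`: the orbit of `x` is defined and
`m(D f_{n+1}) > η` at `f^n x`. -/
def IsExpandingAt {α : ℝ≥0} (f : ℕ → LocDiffeo d M α) (x : M) : Prop :=
  ∃ η : ℝ, 1 < η ∧ ∀ n : ℕ, seqComp f n x ∈ (f n).source ∧
    η < conorm (mfderiv (𝓡 d) (𝓡 d) (f n).toOpenPartialHomeomorph (seqComp f n x))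

/-- The sequence is `κ`-conformal at `x` for some `κ ≥ 1`: all `f^n` are defined at `x` and their
derivatives at `x` are `κ`-conformal. -/
def IsQuasiConformalAt {α : ℝ≥0} (f : ℕ → LocDiffeo d M α) (x : M) : Prop :=
  ∃ κ : ℝ, 1 ≤ κ ∧ ∀ n : ℕ, 1 ≤ n → x ∈ (seqComp f n).source ∧
    IsConformalWith κ (mfderiv (𝓡 d) (𝓡 d) (seqComp f n) x)

end Manifold

/-- The open ball of real radius `r` for the Riemannian distance (which is infinite between
different components of `M`). -/
def rball {M : Type*} [EMetricSpace M] (x : M) (r : ℝ) : Set M :=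
  {y | edist y x < ENNReal.ofReal r}

end ControlGeometry

end

namespace ControlGeometry

/-! ### Distortion control for sequences of maps of a normed space. -/

section Orbits

open Metric

/-! Read in uniformly bi-Lipschitz charts along the orbit of `x`, the maps become `g n`,
Hölder-close to linear maps `D n` with products `A n`. Conjugating by these products gives `h n = (A
(n+1))⁻¹ ∘ g n ∘ A n` (centred at the orbit), whose derivative at `0` is the identity.
Quasi-conformality bounds `‖A n‖ * ‖(A (n+1))⁻¹‖`, so the conjugation costs only a constant factor
and `h n` differs from the identity by a multiple of (radius at time `n`)^α.

Fix the final time `N` and a ball whose image at time `N` has a fixed small size. By expansion its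
size at time `n` is smaller by `η⁻¹ ^ (N - n)`, so the errors of the `h n` form a geometric series
with a small sum, independent of `N`. Hence the composition of the `h n` maps the ball of radius `t`
into that of radius `2 * t` and covers that of radius `t / 2`. Undoing the conjugation, `f^n` maps
balls to nearly round sets, with constants independent of `n`.

The analytic core is `exists_orbit_control`; `exists_isGoodChart` provides the charts, using
compactness; `approximatesLinearOn_coordExpr` turns the norm bound into Hölder-closeness. -/

/-- The orbit of `w` under the sequence of maps `g 0, g 1, …`. -/
def orbit {E : Type*} (g : ℕ → E → E) (w : E) : ℕ → E
  | 0 => w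
  | n + 1 => g n (orbit g w n)

variable {E : Type*} [NormedAddCommGroup E] [NormedSpace ℝ E]

/-- Here `σ` dominates the accumulated errors. As long as the orbit stays in the ball of radius `2 *
t`, step `n` adds at most `2 * t * ε n` to the norm, and `σ ≤ 1 / 2` keeps it in that ball. -/
lemma norm_orbit_le_of_approximatesLinearOn_id {h : ℕ → E → E} (h0 : ∀ n, h n 0 = 0)
    {N : ℕ} {t : ℝ} (ht : 0 ≤ t) {ε : ℕ → ℝ≥0} {σ : ℕ → ℝ}
    (hσ0 : 0 ≤ σ 0) (hσ : ∀ n < N, σ n + ε n ≤ σ (n + 1)) (hσN : ∀ n ≤ N, σ n ≤ 1 / 2)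
    (happ : ∀ n < N, ApproximatesLinearOn (h n) (ContinuousLinearMap.id ℝ E)
      (closedBall 0 (2 * t)) (ε n))
    {u : E} (hu : ‖u‖ ≤ t) {n : ℕ} (hn : n ≤ N) :
    ‖orbit h u n‖ ≤ t * (1 + 2 * σ n) := by
  induction n with
  | zero => simpa [orbit] using hu.trans (le_mul_of_one_le_right ht (by linarith))
  | succ n ih =>
    have ih := ih (by omega)
    have h2 : ‖orbit h u n‖ ≤ 2 * t := ih.trans (by nlinarith [hσN n (by omega)])
    have := happ n (by omega) (orbit h u n) (by simpa using h2) 0 (by simpa using ht)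
    simp only [h0, sub_zero, ContinuousLinearMap.id_apply] at this
    have h3 : ‖h n (orbit h u n)‖ ≤ ‖orbit h u n‖ + ε n * ‖orbit h u n‖ := by
      calc ‖h n (orbit h u n)‖ = ‖orbit h u n + (h n (orbit h u n) - orbit h u n)‖ := by
            congr 1; abel
        _ ≤ _ := (norm_add_le _ _).trans (by gcongr)
    have h4 : (ε n : ℝ) * ‖orbit h u n‖ ≤ ε n * (2 * t) := by gcongr
    have h5 := mul_le_mul_of_nonneg_left (hσ n (by omega)) ht
    change ‖h n (orbit h u n)‖ ≤ _
    nlinarith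

/-- A map `ε n`-close to the identity sends a ball of radius `a` about `0` onto at least the ball of
radius `(1 - ε n) * a`; the preimage is built backwards from time `n`, and the losses are again
absorbed by `σ`. -/
lemma exists_orbit_eq_of_approximatesLinearOn_id [CompleteSpace E] {h : ℕ → E → E}
    (h0 : ∀ n, h n 0 = 0) {N : ℕ} {t : ℝ} (ht : 0 ≤ t) {ε : ℕ → ℝ≥0} {σ : ℕ → ℝ}
    (hσ0 : ∀ n, 0 ≤ σ n) (hσ : ∀ n < N, σ n + ε n ≤ σ (n + 1)) (hσN : ∀ n ≤ N, σ n ≤ 1 / 2)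
    (happ : ∀ n < N, ApproximatesLinearOn (h n) (ContinuousLinearMap.id ℝ E)
      (closedBall 0 (2 * t)) (ε n))
    {n : ℕ} (hn : n ≤ N) {v : E} (hv : ‖v‖ ≤ t * (1 - σ n)) :
    ∃ u : E, ‖u‖ ≤ t ∧ orbit h u n = v := by
  induction n generalizing v with
  | zero => exact ⟨v, hv.trans (by nlinarith [hσ0 0]), rfl⟩
  | succ n ih =>
    have hle := hσN n (by omega)
    have hpos : 0 ≤ t * (1 - σ n) := by nlinarith
    let f' : (ContinuousLinearMap.id ℝ E).NonlinearRightInverse :=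
      { toFun := id, nnnorm := 1, bound' := by simp, right_inv' := by simp }
    have hsurj := (happ n (by omega)).surjOn_closedBall_of_nonlinearRightInverse f' hpos
      (closedBall_subset_closedBall (by nlinarith [hσ0 n]) : closedBall (0 : E) _ ⊆ _)
    have hmem : v ∈ closedBall (h n 0) (((f'.nnnorm : ℝ)⁻¹ - ε n) * (t * (1 - σ n))) := by
      have h5 := mul_le_mul_of_nonneg_left (hσ n (by omega)) ht
      have h6 : 0 ≤ t * (ε n * σ n) := by have := hσ0 n; positivity
      simp only [h0, mem_closedBall_zero_iff, f', NNReal.coe_one, inv_one]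
      nlinarith
    obtain ⟨v', hv', rfl⟩ := hsurj hmem
    obtain ⟨u, hu, rfl⟩ := ih (by omega) (by simpa using hv')
    exact ⟨u, hu, rfl⟩

lemma exists_pos_rpow_mul_le (K : ℝ) {α s₀ ε : ℝ} (hα : 0 < α) (hs₀ : 0 < s₀) (hε : 0 < ε) :
    ∃ s, 0 < s ∧ s < s₀ ∧ K * s ^ α ≤ ε := by
  have h1 : Filter.Tendsto (fun s : ℝ => K * s ^ α) (𝓝[>] 0) (𝓝 0) := by
    have : ContinuousAt (fun s : ℝ => K * s ^ α) 0 :=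
      (Real.continuousAt_rpow_const 0 α (Or.inr hα.le)).const_mul K
    simpa [ContinuousAt, Real.zero_rpow hα.ne'] using this.tendsto.mono_left nhdsWithin_le_nhds
  obtain ⟨s, hs⟩ := ((h1.eventually (ge_mem_nhds hε)).and (Ioo_mem_nhdsGT hs₀)).exists
  exact ⟨s, hs.2.1, hs.2.2, hs.1⟩

lemma le_pow_mul_of_expanding {b : ℕ → ℝ} {η : ℝ} (hη : 0 < η) (hb : ∀ n, η * b n ≤ b (n + 1))
    (n m : ℕ) : b n ≤ η⁻¹ ^ m * b (n + m) := by
  induction m with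
  | zero => simp
  | succ m ih =>
    refine ih.trans ?_
    rw [pow_succ, mul_assoc]
    gcongr
    rw [inv_mul_eq_div, le_div_iff₀ hη, mul_comm, ← add_assoc]
    exact hb _

/-- Maps `g n` which are Hölder-close to linear maps `D n`, whose products `A n` are uniformly
quasi-conformal and expanding, map small round balls to nearly round sets, uniformly in the number
of iterates. -/
theorem exists_orbit_control [FiniteDimensional ℝ E] (g : ℕ → E → E) (c : ℕ → E)
    (D A : ℕ → E →L[ℝ] E) (b : ℕ → ℝ) {C H η s₀ α : ℝ} (hα : 0 < α) (hη : 1 < η)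
    (hs₀ : 0 < s₀) (hC : 0 ≤ C) (hH : 0 < H) (hA0 : A 0 = ContinuousLinearMap.id ℝ E)
    (hA : ∀ n, A (n + 1) = D n ∘L A n) (hc : ∀ n, g n (c n) = c (n + 1))
    (hb0 : ∀ n, 0 < b n) (hb : ∀ n, η * b n ≤ b (n + 1))
    (hAu : ∀ n v, ‖A n v‖ ≤ H * b n * ‖v‖) (hAl : ∀ n v, b n * ‖v‖ ≤ H * ‖A n v‖)
    (happ : ∀ n s, 0 < s → s < s₀ →
      ApproximatesLinearOn (g n) (D n) (closedBall (c n) s) (C * s ^ α).toNNReal) :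
    ∃ τ > 0, ∀ N t, 0 < t → t * b N ≤ τ →
      (∀ w, ‖w - c 0‖ ≤ t → ∀ n ≤ N, ‖orbit g w n - c n‖ < s₀ ∧
        ‖orbit g w n - c n‖ ≤ 2 * H * b n * t) ∧
      ∀ z, 2 * H * ‖z - c N‖ ≤ t * b N → ∃ w, ‖w - c 0‖ ≤ t ∧ orbit g w N = z := by
  have : CompleteSpace E := FiniteDimensional.complete ℝ E
  have hη0 : 0 < η := zero_lt_one.trans hη
  -- One step back in time divides radii by at least `η`, hence multiplies Hölder errors by at most
  -- `q`.
  set q : ℝ := η⁻¹ ^ α with hq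
  have hq0 : 0 < q := by positivity
  have hq1 : q < 1 := Real.rpow_lt_one (by positivity) (inv_lt_one_of_one_lt₀ hη) hα
  -- With this `s`, the error series `∑ ε₀ * q ^ m = ε₀ / (1 - q)` is at most `1 / 2`.
  obtain ⟨s, hs, hss₀, hsε⟩ := exists_pos_rpow_mul_le (H ^ 2 * C) hα hs₀
    (ε := (1 - q) / 2) (by linarith)
  -- This `τ` makes the radius `H * b N * (2 * t)` at time `N` at most `s`.
  refine ⟨s / (2 * H), by positivity, fun N t ht htN => ?_⟩
  have hinj : ∀ n, Function.Injective (A n) := fun n => by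
    rw [injective_iff_map_eq_zero]
    intro v hv
    have := hAl n v
    rw [hv, norm_zero, mul_zero] at this
    exact norm_eq_zero.mp (le_antisymm (nonpos_of_mul_nonpos_right this (hb0 n)) (norm_nonneg v))
  let B : ℕ → E ≃ₗ[ℝ] E := fun n => LinearEquiv.ofInjectiveEndo (A n : E →ₗ[ℝ] E) (hinj n)
  have hB : ∀ n v, A n ((B n).symm v) = v := fun n v => (B n).apply_symm_apply v
  have hBA : ∀ n v, (B n).symm (A n v) = v := fun n v => (B n).symm_apply_apply v
  have hBn : ∀ n v, ‖(B n).symm v‖ ≤ H / b n * ‖v‖ := fun n v => by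
    have := hAl n ((B n).symm v)
    rw [hB] at this
    rw [div_mul_eq_mul_div, le_div_iff₀ (hb0 n), mul_comm]
    exact this
  let h : ℕ → E → E := fun n u => (B (n + 1)).symm (g n (c n + A n u) - c (n + 1))
  have h0 : ∀ n, h n 0 = 0 := fun n => by simp [h, hc]
  have horb : ∀ u n, orbit g (c 0 + u) n = c n + A n (orbit h u n) := fun u n => by
    induction n with
    | zero => simp [orbit, hA0]
    | succ n ih => simp [orbit, h, ih, hB]
  have hbmono : ∀ n, b n ≤ b (n + 1) := fun n => by nlinarith [hb n, hb0 n]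
  set ε₀ : ℝ := H ^ 2 * C * s ^ α with hε₀
  have hε₀0 : 0 ≤ ε₀ := by positivity
  -- the radius in the `n`-th space which contains the images of the balls under consideration
  have hrad : ∀ n ≤ N, H * b n * (2 * t) ≤ s * η⁻¹ ^ (N - n) := fun n hn => by
    obtain ⟨m, rfl⟩ := Nat.exists_eq_add_of_le hn
    rw [Nat.add_sub_cancel_left]
    rw [le_div_iff₀ (by positivity)] at htN
    calc H * b n * (2 * t) ≤ H * (η⁻¹ ^ m * b (n + m)) * (2 * t) := by
          gcongr; exact le_pow_mul_of_expanding hη0 hb n m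
      _ = t * b (n + m) * (2 * H) * η⁻¹ ^ m := by ring
      _ ≤ s * η⁻¹ ^ m := by gcongr
  have hsmall : ∀ m : ℕ, s * η⁻¹ ^ m < s₀ := fun m => by
    refine lt_of_le_of_lt (mul_le_of_le_one_right hs.le ?_) hss₀
    exact pow_le_one₀ (by positivity) (inv_le_one_of_one_le₀ hη.le)
  have hεpow : ∀ m : ℕ, H ^ 2 * (C * (s * η⁻¹ ^ m) ^ α) = ε₀ * q ^ m := fun m => by
    rw [Real.mul_rpow hs.le (by positivity), hε₀, hq, Real.rpow_pow_comm (by positivity)]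
    ring
  have happ' : ∀ n < N, ApproximatesLinearOn (h n) (ContinuousLinearMap.id ℝ E)
      (closedBall 0 (2 * t)) (ε₀ * q ^ (N - n)).toNNReal := by
    intro n hn u hu u' hu'
    have hmem : ∀ u ∈ closedBall (0 : E) (2 * t),
        c n + A n u ∈ closedBall (c n) (s * η⁻¹ ^ (N - n)) := fun u hu => by
      rw [mem_closedBall_zero_iff] at hu
      simp only [mem_closedBall, dist_self_add_left]
      refine ((hAu n u).trans ?_).trans (hrad n hn.le)
      have := (hb0 n).le
      gcongr
    have key := happ n _ (by positivity) (hsmall (N - n)) _ (hmem u hu) _ (hmem u' hu')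
    have hrw : h n u - h n u' - (ContinuousLinearMap.id ℝ E) (u - u') =
        (B (n + 1)).symm (g n (c n + A n u) - g n (c n + A n u') -
          D n (c n + A n u - (c n + A n u'))) := by
      have h1 : D n (c n + A n u - (c n + A n u')) = A (n + 1) (u - u') := by
        rw [hA, ContinuousLinearMap.comp_apply, map_sub (A n)]
        congr 1; abel
      rw [h1, map_sub (B (n + 1)).symm, hBA]
      simp only [h, ContinuousLinearMap.id_apply, ← map_sub]
      congr 2; abel
    rw [hrw]
    have hn0 := hb0 n
    have hn1 := hb0 (n + 1)
    rw [Real.coe_toNNReal _ (by positivity)] at key ⊢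
    rw [← hεpow]
    -- The two conjugating maps contribute `H / b (n + 1)` and `H * b n`; since `b` is
    -- nondecreasing, only `H ^ 2` remains.
    calc _ ≤ H / b (n + 1) * (C * (s * η⁻¹ ^ (N - n)) ^ α *
            ‖c n + A n u - (c n + A n u')‖) := (hBn _ _).trans (by gcongr)
      _ ≤ H / b (n + 1) * (C * (s * η⁻¹ ^ (N - n)) ^ α * (H * b n * ‖u - u'‖)) := by
          gcongr
          rw [add_sub_add_left_eq_sub, ← map_sub]
          exact hAu n _
      _ = b n / b (n + 1) * (H ^ 2 * (C * (s * η⁻¹ ^ (N - n)) ^ α) * ‖u - u'‖) := by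
          field_simp
      _ ≤ _ := mul_le_of_le_one_left (by positivity) ((div_le_one hn1).mpr (hbmono n))
  -- The increment of `σ` from `n` to `n + 1` is `ε₀ * q ^ (N - n - 1)`, which dominates the error
  -- `ε₀ * q ^ (N - n)`.
  let σ : ℕ → ℝ := fun n => ε₀ / (1 - q) * q ^ (N - n)
  have hq1' : 0 < 1 - q := by linarith
  have hσ0 : ∀ n, 0 ≤ σ n := fun n => by positivity
  have hσ : ∀ n < N, σ n + (ε₀ * q ^ (N - n)).toNNReal ≤ σ (n + 1) := fun n hn => by
    obtain ⟨m, rfl⟩ := Nat.exists_eq_add_of_lt hn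
    rw [Real.coe_toNNReal _ (by positivity)]
    have e1 : n + m + 1 - n = m + 1 := by omega
    have e2 : n + m + 1 - (n + 1) = m := by omega
    simp only [σ, e1, e2]
    have : ε₀ / (1 - q) * q ^ m - ε₀ / (1 - q) * q ^ (m + 1) = ε₀ * q ^ m := by
      field_simp; ring
    have : ε₀ * q ^ (m + 1) ≤ ε₀ * q ^ m :=
      mul_le_mul_of_nonneg_left (pow_le_pow_of_le_one hq0.le hq1.le (Nat.le_succ m)) hε₀0
    linarith
  have hσN : ∀ n ≤ N, σ n ≤ 1 / 2 := fun n _ => by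
    have h1 : ε₀ / (1 - q) ≤ 1 / 2 := by rw [div_le_iff₀ hq1']; linarith
    exact (mul_le_of_le_one_right (by positivity) (pow_le_one₀ hq0.le hq1.le)).trans h1
  constructor
  · intro w hw n hn
    have hle := norm_orbit_le_of_approximatesLinearOn_id h0 ht.le (hσ0 0) hσ hσN happ' hw hn
    have hle2 : ‖orbit h (w - c 0) n‖ ≤ 2 * t := hle.trans (by nlinarith [hσN n hn])
    have hw' := horb (w - c 0) n
    rw [add_sub_cancel] at hw'
    rw [hw', add_sub_cancel_left]
    have hn0 := hb0 n
    have hle3 : ‖A n (orbit h (w - c 0) n)‖ ≤ H * b n * (2 * t) :=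
      (hAu n _).trans (by gcongr)
    exact ⟨hle3.trans_lt ((hrad n hn).trans_lt (hsmall _)), hle3.trans (by linarith)⟩
  · intro z hz
    have hz' : ‖(B N).symm (z - c N)‖ ≤ t * (1 - σ N) := by
      have h1 : ‖(B N).symm (z - c N)‖ ≤ t / 2 := by
        refine (hBn N _).trans ?_
        rw [div_mul_eq_mul_div, div_le_iff₀ (hb0 N)]
        linarith
      nlinarith [hσN N le_rfl]
    obtain ⟨u, hu, huN⟩ :=
      exists_orbit_eq_of_approximatesLinearOn_id h0 ht.le hσ0 hσ hσN happ' le_rfl hz'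
    exact ⟨c 0 + u, by simpa using hu, by rw [horb, huN, hB]; abel⟩

end Orbits

/-! ### Derivative bounds and Riemannian distance. -/

section PathLength

open Manifold Metric

variable {E : Type*} [NormedAddCommGroup E] [NormedSpace ℝ E] {H : Type*} [TopologicalSpace H]
  {I : ModelWithCorners ℝ E H} {M : Type*} [PseudoEMetricSpace M] [ChartedSpace H M]
  [RiemannianBundle (fun x : M => TangentSpace I x)] [IsRiemannianManifold I M]
  {E' : Type*} [NormedAddCommGroup E'] [NormedSpace ℝ E'] {H' : Type*} [TopologicalSpace H']
  {I' : ModelWithCorners ℝ E' H'} {M' : Type*} [PseudoEMetricSpace M'] [ChartedSpace H' M']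
  [RiemannianBundle (fun x : M' => TangentSpace I' x)] [IsRiemannianManifold I' M']

/-- A map whose derivative is bounded by `C` on a ball expands the distance to the center at most
by the factor `C`. -/
lemma edist_le_mul_edist_of_enorm_mfderiv_le {F : M → M'} {y z : M} {R : ℝ≥0∞} {C : ℝ≥0}
    (hF : ContMDiffOn I I' 1 F (eball y R))
    (hC : ∀ p ∈ eball y R, ∀ v : TangentSpace I p, ‖mfderiv I I' F p v‖ₑ ≤ C * ‖v‖ₑ)
    (hz : z ∈ eball y R) : edist (F y) (F z) ≤ C * edist y z := by
  rw [mem_eball'] at hz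
  -- A path from `y` of length less than `r < R` cannot leave the ball, so the derivative bound
  -- holds all along it; `r` then decreases to `edist y z`.
  have key : ∀ r ∈ Ioo (edist y z) R, edist (F y) (F z) ≤ C * r := by
    rintro r ⟨hr, hrR⟩
    rw [IsRiemannianManifold.out (I := I)] at hr
    obtain ⟨γ, hγ0, hγ1, hγ, hlen⟩ := exists_lt_of_riemannianEDist_lt hr
    have hmem : ∀ t ∈ Icc (0 : ℝ) 1, γ t ∈ eball y R := fun t ht => by
      rw [mem_eball', IsRiemannianManifold.out (I := I)]
      refine lt_of_le_of_lt ?_ (hlen.trans hrR)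
      exact (riemannianEDist_le_pathELength (hγ.mono (Icc_subset_Icc_right ht.2)) hγ0 rfl
        ht.1).trans (pathELength_mono le_rfl ht.2)
    rw [IsRiemannianManifold.out (I := I')]
    calc riemannianEDist I' (F y) (F z) ≤ pathELength I' (F ∘ γ) 0 1 :=
          riemannianEDist_le_pathELength (hF.comp hγ hmem) (by simp [hγ0]) (by simp [hγ1])
            zero_le_one
      _ ≤ C * pathELength I γ 0 1 := by
          rw [pathELength_eq_lintegral_mfderivWithin_Icc, pathELength_eq_lintegral_mfderivWithin_Icc,
            ← MeasureTheory.lintegral_const_mul' _ _ ENNReal.coe_ne_top]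
          refine MeasureTheory.setLIntegral_mono' measurableSet_Icc fun t ht => ?_
          have h1 : mfderivWithin 𝓘(ℝ, ℝ) I' (F ∘ γ) (Icc 0 1) t =
              (mfderiv I I' F (γ t)).comp (mfderivWithin 𝓘(ℝ, ℝ) I γ (Icc 0 1) t) := by
            refine mfderiv_comp_mfderivWithin t ?_ (hγ.mdifferentiableOn one_ne_zero t ht) ?_
            · exact (hF.mdifferentiableOn one_ne_zero).mdifferentiableAt
                (isOpen_eball.mem_nhds (hmem t ht))
            · rw [uniqueMDiffWithinAt_iff_uniqueDiffWithinAt]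
              exact uniqueDiffOn_Icc zero_lt_one t ht
          rw [h1]
          exact hC _ (hmem t ht) _
      _ ≤ C * r := by gcongr
  have hlt : edist y z < ⊤ := hz.trans_le le_top
  have : (𝓝[>] (edist y z)).NeBot := nhdsGT_neBot_of_exists_gt ⟨⊤, hlt⟩
  have hcont : Filter.Tendsto (fun r : ℝ≥0∞ => C * r) (𝓝[>] (edist y z)) (𝓝 (C * edist y z)) :=
    ((ENNReal.continuous_const_mul ENNReal.coe_ne_top).tendsto _).mono_left nhdsWithin_le_nhds
  exact ge_of_tendsto hcont (Filter.mem_of_superset (Ioo_mem_nhdsGT hz) key)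

end PathLength

/-! ### Comparison of chart derivatives with the Riemannian norm. -/

section ChartDerivatives

open Manifold Metric

variable {d : ℕ} {M : Type*} [TopologicalSpace M] [ChartedSpace (EuclideanSpace ℝ (Fin d)) M]

/-- The derivative at `q` of a map from `M` to Euclidean space, with values in that space. -/
noncomputable def chartDeriv (φ : M → EuclideanSpace ℝ (Fin d)) (q : M) :
    TangentSpace (𝓡 d) q →ₗ[ℝ] EuclideanSpace ℝ (Fin d) :=
  (mfderiv (𝓡 d) (𝓡 d) φ q).toLinearMap

lemma chartDeriv_congr {φ ψ : M → EuclideanSpace ℝ (Fin d)} {q : M} (h : φ =ᶠ[𝓝 q] ψ)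
    (v : TangentSpace (𝓡 d) q) : chartDeriv φ q v = chartDeriv ψ q v :=
  congr($(h.mfderiv_eq (I := 𝓡 d) (I' := 𝓡 d)) v)

lemma chartDeriv_comp {g : EuclideanSpace ℝ (Fin d) → EuclideanSpace ℝ (Fin d)}
    {φ : M → EuclideanSpace ℝ (Fin d)} {q : M} (hg : DifferentiableAt ℝ g (φ q))
    (hφ : MDifferentiableAt (𝓡 d) (𝓡 d) φ q) (v : TangentSpace (𝓡 d) q) :
    chartDeriv (g ∘ φ) q v = fderiv ℝ g (φ q) (chartDeriv φ q v) := by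
  have := mfderiv_comp (I := 𝓡 d) (I' := 𝓡 d) (I'' := 𝓡 d) q hg.mdifferentiableAt hφ
  rw [mfderiv_eq_fderiv] at this
  exact congr($this v)

lemma chartDeriv_comp_mfderiv {φ : M → EuclideanSpace ℝ (Fin d)} {f : M → M} {q : M}
    (hφ : MDifferentiableAt (𝓡 d) (𝓡 d) φ (f q)) (hf : MDifferentiableAt (𝓡 d) (𝓡 d) f q)
    (v : TangentSpace (𝓡 d) q) :
    chartDeriv (φ ∘ f) q v = chartDeriv φ (f q) (mfderiv (𝓡 d) (𝓡 d) f q v) :=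
  congr($(mfderiv_comp (I := 𝓡 d) (I' := 𝓡 d) (I'' := 𝓡 d) q hφ hf) v)

/-- The transition map is smooth, so the norm of its derivative is locally bounded. This carries the
bounds for `chartAt` over to every chart of the maximal atlas. -/
lemma exists_chartDeriv_le_chartDeriv {φ ψ : OpenPartialHomeomorph M (EuclideanSpace ℝ (Fin d))}
    (hφ : φ ∈ IsManifold.maximalAtlas (𝓡 d) ∞ M) (hψ : ψ ∈ IsManifold.maximalAtlas (𝓡 d) ∞ M)
    {p : M} (hpφ : p ∈ φ.source) (hpψ : p ∈ ψ.source) :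
    ∃ C > 0, ∀ᶠ q in 𝓝 p, ∀ v : TangentSpace (𝓡 d) q,
      ‖chartDeriv φ q v‖ ≤ C * ‖chartDeriv ψ q v‖ := by
  let T : EuclideanSpace ℝ (Fin d) → EuclideanSpace ℝ (Fin d) := φ ∘ ψ.symm
  have hT : ContDiffOn ℝ ∞ T (ψ.symm ≫ₕ φ).source := by
    refine ContMDiffOn.contDiffOn (ContMDiffOn.comp (contMDiffOn_of_mem_maximalAtlas hφ)
      ((contMDiffOn_symm_of_mem_maximalAtlas hψ).mono ?_) ?_)
    · exact fun w hw => by simpa using hw.1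
    · exact fun w hw => by simpa using hw.2
  have hopen : IsOpen (ψ.symm ≫ₕ φ).source := (ψ.symm ≫ₕ φ).open_source
  have hmem : ψ p ∈ (ψ.symm ≫ₕ φ).source := by simp [hpψ, hpφ]
  have hcont : ContinuousAt (fun w => ‖fderiv ℝ T w‖) (ψ p) :=
    ((hT.continuousOn_fderiv_of_isOpen hopen (by simp)).continuousAt
      (hopen.mem_nhds hmem)).norm
  refine ⟨‖fderiv ℝ T (ψ p)‖ + 1, by positivity, ?_⟩
  have h1 := (hcont.comp (ψ.continuousAt hpψ)).eventually_lt_const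
    (show ‖fderiv ℝ T (ψ p)‖ < ‖fderiv ℝ T (ψ p)‖ + 1 by linarith)
  have h2 := (ψ.continuousAt hpψ).preimage_mem_nhds (hopen.mem_nhds hmem)
  filter_upwards [h1, h2, ψ.open_source.mem_nhds hpψ] with q hq1 hq2 hq3 v
  have heq : (φ : M → _) =ᶠ[𝓝 q] T ∘ ψ := by
    filter_upwards [ψ.open_source.mem_nhds hq3] with a ha
    simp [T, ψ.left_inv ha]
  rw [chartDeriv_congr heq, chartDeriv_comp]
  · exact ((fderiv ℝ T (ψ q)).le_opNorm _).trans
      (mul_le_mul_of_nonneg_right hq1.le (norm_nonneg _))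
  · exact (hT.differentiableOn (by simp)).differentiableAt (hopen.mem_nhds hq2)
  · exact ((contMDiffOn_of_mem_maximalAtlas hψ).mdifferentiableOn (by simp)).mdifferentiableAt
      (ψ.open_source.mem_nhds hq3)

variable [IsManifold (𝓡 d) ∞ M] [RiemannianBundle (fun x : M => TangentSpace (𝓡 d) x)]
  [IsContMDiffRiemannianBundle (𝓡 d) ∞ (EuclideanSpace ℝ (Fin d))
    (fun x : M => TangentSpace (𝓡 d) x)]

lemma exists_chartDeriv_chartAt_bounds (p : M) :
    ∃ C > 0, ∀ᶠ q in 𝓝 p, ∀ v : TangentSpace (𝓡 d) q,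
      ‖chartDeriv (chartAt (EuclideanSpace ℝ (Fin d)) p) q v‖ ≤ C * ‖v‖ ∧
      ‖v‖ ≤ C * ‖chartDeriv (chartAt (EuclideanSpace ℝ (Fin d)) p) q v‖ := by
  have : IsManifold (𝓡 d) 1 M := IsManifold.of_le (n := ∞) (by simp)
  have : IsContinuousRiemannianBundle (EuclideanSpace ℝ (Fin d))
    (fun x : M => TangentSpace (𝓡 d) x) := by
    obtain ⟨g, hg, hgv⟩ := IsContMDiffRiemannianBundle.exists_contMDiff (IB := 𝓡 d) (n := ∞)
      (F := EuclideanSpace ℝ (Fin d)) (E := fun x : M => TangentSpace (𝓡 d) x)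
    exact ⟨g, hg.continuous, hgv⟩
  obtain ⟨C₁, hC₁, h₁⟩ := eventually_norm_mfderiv_extChartAt_lt (𝓡 d) p
  obtain ⟨C₂, hC₂, h₂⟩ := eventually_norm_mfderivWithin_symm_extChartAt_comp_lt (𝓡 d) p
  refine ⟨max C₁ C₂, by positivity, ?_⟩
  filter_upwards [h₁, h₂, extChartAt_source_mem_nhds (I := 𝓡 d) p] with q hq₁ hq₂ hq v
  constructor
  · refine le_trans ?_ (mul_le_mul_of_nonneg_right (le_max_left C₁ C₂) (norm_nonneg v))
    refine le_trans ?_ (mul_le_mul_of_nonneg_right hq₁.le (norm_nonneg v))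
    exact ContinuousLinearMap.le_opNorm _ v
  · refine le_trans ?_ (mul_le_mul_of_nonneg_right (le_max_right C₁ C₂) (norm_nonneg _))
    refine le_trans ?_ (mul_le_mul_of_nonneg_right hq₂.le (norm_nonneg _))
    have hv := congr($(mfderivWithin_extChartAt_symm_comp_mfderiv_extChartAt' hq) v)
    -- Tangent spaces at all points are the same type, but the norm depends on the base point; the
    -- round trip through the chart ends at a point only propositionally equal to `q`.
    have hnorm : ∀ q' : M, q' = q → ∀ (w : TangentSpace (𝓡 d) q) (w' : TangentSpace (𝓡 d) q'),
        @Eq (EuclideanSpace ℝ (Fin d)) w w' → ‖w‖ = ‖w'‖ := by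
      rintro _ rfl w w' h
      exact congrArg _ h
    refine le_trans (le_of_eq ?_) (ContinuousLinearMap.le_opNorm _
      (chartDeriv (chartAt (EuclideanSpace ℝ (Fin d)) p) q v))
    exact hnorm _ ((extChartAt (𝓡 d) p).left_inv hq) v _ hv.symm

lemma exists_chartDeriv_bounds {φ : OpenPartialHomeomorph M (EuclideanSpace ℝ (Fin d))}
    (hφ : φ ∈ IsManifold.maximalAtlas (𝓡 d) ∞ M) {p : M} (hp : p ∈ φ.source) :
    ∃ C > 0, ∀ᶠ q in 𝓝 p, ∀ v : TangentSpace (𝓡 d) q,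
      ‖chartDeriv φ q v‖ ≤ C * ‖v‖ ∧ ‖v‖ ≤ C * ‖chartDeriv φ q v‖ := by
  have hψ := IsManifold.chart_mem_maximalAtlas (I := 𝓡 d) (n := ∞) p
  have hpψ := mem_chart_source (EuclideanSpace ℝ (Fin d)) p
  obtain ⟨C, hC, h⟩ := exists_chartDeriv_chartAt_bounds (d := d) p
  obtain ⟨C₁, hC₁, h₁⟩ := exists_chartDeriv_le_chartDeriv hφ hψ hp hpψ
  obtain ⟨C₂, hC₂, h₂⟩ := exists_chartDeriv_le_chartDeriv hψ hφ hpψ hp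
  refine ⟨max (C₁ * C) (C * C₂), by positivity, ?_⟩
  filter_upwards [h, h₁, h₂] with q hq hq₁ hq₂ v
  constructor
  · calc ‖chartDeriv φ q v‖ ≤ C₁ * (C * ‖v‖) :=
          (hq₁ v).trans (mul_le_mul_of_nonneg_left (hq v).1 hC₁.le)
      _ = C₁ * C * ‖v‖ := by ring
      _ ≤ _ := mul_le_mul_of_nonneg_right (le_max_left _ _) (norm_nonneg _)
  · calc ‖v‖ ≤ C * (C₂ * ‖chartDeriv φ q v‖) :=
          (hq v).2.trans (mul_le_mul_of_nonneg_left (hq₂ v) hC.le)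
      _ = C * C₂ * ‖chartDeriv φ q v‖ := by ring
      _ ≤ _ := mul_le_mul_of_nonneg_right (le_max_right _ _) (norm_nonneg _)

end ChartDerivatives
-- Uniformly bi-Lipschitz charts.
section GoodCharts

open Manifold Metric

lemma enorm_le_toNNReal_mul_enorm {V W : Type*} [SeminormedAddCommGroup V]
    [SeminormedAddCommGroup W] {C : ℝ} (hC : 0 ≤ C) {v : V} {w : W} (h : ‖v‖ ≤ C * ‖w‖) :
    ‖v‖ₑ ≤ C.toNNReal * ‖w‖ₑ := by
  rw [← ofReal_norm, ← ofReal_norm, ← ENNReal.ofReal, ← ENNReal.ofReal_mul hC]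
  exact ENNReal.ofReal_le_ofReal h

section RBall

variable {M : Type*} [EMetricSpace M]

lemma isOpen_rball (x : M) (r : ℝ) : IsOpen (rball x r) := isOpen_eball

lemma mem_rball_self (x : M) {r : ℝ} (hr : 0 < r) : x ∈ rball x r := by
  simpa [rball] using hr

lemma rball_subset_rball {x : M} {r r' : ℝ} (h : r ≤ r') : rball x r ⊆ rball x r' :=
  eball_subset_eball (ENNReal.ofReal_le_ofReal h)

lemma rball_subset_rball_of_mem {x y : M} {r s t : ℝ} (hy : y ∈ rball x r) (hs : 0 ≤ s)
    (h : r + s ≤ t) : rball y s ⊆ rball x t := by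
  intro z hz
  have hr : 0 < r := by
    by_contra! hr
    simp [rball, ENNReal.ofReal_of_nonpos hr] at hy
  calc edist z x ≤ edist z y + edist y x := edist_triangle _ _ _
    _ < ENNReal.ofReal s + ENNReal.ofReal r := ENNReal.add_lt_add hz hy
    _ ≤ ENNReal.ofReal t := by
      rw [← ENNReal.ofReal_add hs hr.le]
      exact ENNReal.ofReal_le_ofReal (by linarith)

lemma mem_rball_of_mem_rball_third {x y z : M} {r : ℝ} (hy : y ∈ rball x (r / 3))
    (hz : z ∈ rball x (r / 3)) (hr : 0 < r) : z ∈ rball y (2 * r / 3) := by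
  have hx : x ∈ rball y (r / 3) := by simpa [rball, edist_comm] using hy
  exact rball_subset_rball_of_mem hx (by positivity) (by linarith) hz

lemma exists_rball_subset_of_mem_nhds {x : M} {U : Set M} (h : U ∈ 𝓝 x) :
    ∃ r > 0, rball x r ⊆ U := by
  obtain ⟨ε, hε, hU⟩ := EMetric.mem_nhds_iff.mp h
  obtain ⟨r, hr, hrε⟩ := ENNReal.lt_iff_exists_nnreal_btwn.mp hε
  refine ⟨r, by exact_mod_cast hr, (eball_subset_eball ?_).trans hU⟩
  simpa using hrε.le

end RBall

variable {d : ℕ} {M : Type*} [EMetricSpace M] [ChartedSpace (EuclideanSpace ℝ (Fin d)) M]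
  [RiemannianBundle (fun x : M => TangentSpace (𝓡 d) x)]

/-- `φ` is `L`-bi-Lipschitz on the ball of radius `δ` around `q`, which lies in `K`, its derivative
at `q` is bounded by `L` in both directions, and the image of the ball contains the ball of radius
`δ / L`. -/
structure IsGoodChart (φ : OpenPartialHomeomorph M (EuclideanSpace ℝ (Fin d))) (K : Set M) (q : M)
    (L δ : ℝ) : Prop where
  ball_subset : rball q δ ⊆ K
  edist_le : ∀ a ∈ rball q δ, ∀ b ∈ rball q δ, edist (φ a) (φ b) ≤ ENNReal.ofReal L * edist a b
  le_edist : ∀ a ∈ rball q δ, ∀ b ∈ rball q δ, edist a b ≤ ENNReal.ofReal L * edist (φ a) (φ b)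
  deriv_le : ∀ v : TangentSpace (𝓡 d) q, ‖chartDeriv φ q v‖ ≤ L * ‖v‖
  le_deriv : ∀ v : TangentSpace (𝓡 d) q, ‖v‖ ≤ L * ‖chartDeriv φ q v‖
  ball_subset_image : ball (φ q) (δ / L) ⊆ φ '' rball q δ

-- Pulls closeness in coordinates back to closeness in `M`.
omit [ChartedSpace (EuclideanSpace ℝ (Fin d)) M]
  [RiemannianBundle (fun x : M => TangentSpace (𝓡 d) x)] in
lemma mem_rball_of_edist_le {φ : M → EuclideanSpace ℝ (Fin d)} {a b : M} {L r δ : ℝ} (hL : 0 < L)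
    (h : edist a b ≤ ENNReal.ofReal L * edist (φ a) (φ b)) (hr : dist (φ a) (φ b) < r)
    (hδ : L * r ≤ δ) : a ∈ rball b δ := by
  refine h.trans_lt ?_
  rw [edist_dist, ← ENNReal.ofReal_mul hL.le]
  exact (ENNReal.ofReal_lt_ofReal_iff_of_nonneg (by positivity)).mpr
    ((mul_lt_mul_of_pos_left hr hL).trans_le hδ)

lemma IsGoodChart.mono {φ : OpenPartialHomeomorph M (EuclideanSpace ℝ (Fin d))} {K : Set M} {q : M}
    {L δ L' δ' : ℝ} (h : IsGoodChart φ K q L δ) (hL : 0 < L) (hLL' : L ≤ L') (hδ' : 0 < δ')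
    (hδ : δ' ≤ δ) : IsGoodChart φ K q L' δ' where
  ball_subset := (rball_subset_rball hδ).trans h.ball_subset
  edist_le a ha b hb := (h.edist_le a (rball_subset_rball hδ ha) b
    (rball_subset_rball hδ hb)).trans (by gcongr)
  le_edist a ha b hb := (h.le_edist a (rball_subset_rball hδ ha) b
    (rball_subset_rball hδ hb)).trans (by gcongr)
  deriv_le v := (h.deriv_le v).trans (by gcongr)
  le_deriv v := (h.le_deriv v).trans (by gcongr)
  ball_subset_image := by
    intro w hw
    have hle : δ' / L' ≤ δ' / L := by gcongr
    obtain ⟨a, ha, rfl⟩ := h.ball_subset_image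
      (ball_subset_ball (hle.trans (by gcongr)) hw)
    refine ⟨a, mem_rball_of_edist_le hL (h.le_edist a ha q (mem_rball_self q (by linarith))) hw ?_,
      rfl⟩
    calc L * (δ' / L') ≤ L * (δ' / L) := by gcongr
      _ = δ' := by field_simp

variable [IsManifold (𝓡 d) ∞ M]
  [IsContMDiffRiemannianBundle (𝓡 d) ∞ (EuclideanSpace ℝ (Fin d))
    (fun x : M => TangentSpace (𝓡 d) x)]
  [IsRiemannianManifold (𝓡 d) M]

/-- The path-length estimate is applied to `φ` and to `φ.symm`. The radii are cut to a third so that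
a ball about `a` that contains `b` still lies where the derivative bounds hold. -/
lemma exists_bilipschitz_nhds {φ : OpenPartialHomeomorph M (EuclideanSpace ℝ (Fin d))}
    (hφ : φ ∈ IsManifold.maximalAtlas (𝓡 d) ∞ M) {p : M} (hp : p ∈ φ.source) :
    ∃ C > 0, (∀ᶠ q in 𝓝 p, ∀ v : TangentSpace (𝓡 d) q,
      ‖chartDeriv φ q v‖ ≤ C * ‖v‖ ∧ ‖v‖ ≤ C * ‖chartDeriv φ q v‖) ∧
      ∃ V ∈ 𝓝 p, ∀ a ∈ V, ∀ b ∈ V,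
        edist (φ a) (φ b) ≤ ENNReal.ofReal C * edist a b ∧
        edist a b ≤ ENNReal.ofReal C * edist (φ a) (φ b) := by
  obtain ⟨C, hC, hbd⟩ := exists_chartDeriv_bounds hφ hp
  refine ⟨C, hC, ?_⟩
  have hU : {q | ∀ v : TangentSpace (𝓡 d) q,
      ‖chartDeriv φ q v‖ ≤ C * ‖v‖ ∧ ‖v‖ ≤ C * ‖chartDeriv φ q v‖} ∩ φ.source ∈ 𝓝 p :=
    Filter.inter_mem hbd (φ.open_source.mem_nhds hp)
  obtain ⟨R, hR, hRU⟩ := exists_rball_subset_of_mem_nhds hU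
  have hU' : φ.target ∩ φ.symm ⁻¹' rball p R ∈ 𝓝 (φ p) := by
    refine Filter.inter_mem (φ.open_target.mem_nhds (φ.map_source hp)) ?_
    refine (φ.continuousAt_symm (φ.map_source hp)).preimage_mem_nhds ?_
    rw [φ.left_inv hp]
    exact (isOpen_rball p R).mem_nhds (mem_rball_self p hR)
  obtain ⟨s, hs, hsU⟩ := exists_rball_subset_of_mem_nhds hU'
  have hsm := contMDiffOn_of_mem_maximalAtlas hφ
  have hsm' := contMDiffOn_symm_of_mem_maximalAtlas hφ
  refine ⟨hbd, rball p (R / 3) ∩ (φ.source ∩ φ ⁻¹' rball (φ p) (s / 3)), ?_, ?_⟩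
  · refine Filter.inter_mem ((isOpen_rball _ _).mem_nhds (mem_rball_self p (by positivity))) ?_
    exact Filter.inter_mem (φ.open_source.mem_nhds hp) ((φ.continuousAt hp).preimage_mem_nhds
      ((isOpen_rball _ _).mem_nhds (mem_rball_self _ (by positivity))))
  rintro a ⟨ha₁, ha₂, ha₃⟩ b ⟨hb₁, hb₂, hb₃⟩
  constructor
  · have hsub : rball a (2 * R / 3) ⊆ rball p R :=
      rball_subset_rball_of_mem ha₁ (by positivity) (by linarith)
    refine edist_le_mul_edist_of_enorm_mfderiv_le (I := 𝓡 d) (I' := 𝓡 d)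
      (R := ENNReal.ofReal (2 * R / 3)) ((hsm.of_le (by simp)).mono fun z hz => (hRU (hsub hz)).2)
      (fun z hz v => ?_) (mem_rball_of_mem_rball_third ha₁ hb₁ hR)
    refine enorm_le_toNNReal_mul_enorm hC.le ?_
    rw [norm_tangentSpace_vectorSpace]
    exact ((hRU (hsub hz)).1 v).1
  · have hsub : rball (φ a) (2 * s / 3) ⊆ rball (φ p) s :=
      rball_subset_rball_of_mem ha₃ (by positivity) (by linarith)
    have key := edist_le_mul_edist_of_enorm_mfderiv_le (I := 𝓡 d) (I' := 𝓡 d) (F := φ.symm)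
      (y := φ a) (z := φ b) (C := C.toNNReal)
      (R := ENNReal.ofReal (2 * s / 3)) ((hsm'.of_le (by simp)).mono fun z hz => (hsU (hsub hz)).1)
      (fun z hz v => ?_) (mem_rball_of_mem_rball_third ha₃ hb₃ hs)
    · rwa [φ.left_inv ha₂, φ.left_inv hb₂] at key
    refine enorm_le_toNNReal_mul_enorm hC.le ?_
    rw [norm_tangentSpace_vectorSpace]
    have hz₁ := (hsU (hsub hz)).1
    have hz₂ := hRU (hsU (hsub hz)).2
    -- The lower bound for the derivative of `φ` is used on the image of `v` under the derivative of
    -- `φ.symm`, which the derivative of `φ` sends back to `v`.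
    refine (hz₂.1 _).2.trans (le_of_eq ?_)
    congr 2
    have hd := mfderiv_comp (I := 𝓡 d) (I' := 𝓡 d) (I'' := 𝓡 d) z
      ((hsm.mdifferentiableOn (by simp)).mdifferentiableAt (φ.open_source.mem_nhds hz₂.2))
      ((hsm'.mdifferentiableOn (by simp)).mdifferentiableAt (φ.open_target.mem_nhds hz₁))
    have hid : (φ ∘ φ.symm) =ᶠ[𝓝 z] id := by
      filter_upwards [φ.open_target.mem_nhds hz₁] with w hw using φ.right_inv hw
    rw [hid.mfderiv_eq, mfderiv_id] at hd
    exact congr($hd v).symm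

lemma exists_isGoodChart_nhds {φ : OpenPartialHomeomorph M (EuclideanSpace ℝ (Fin d))}
    (hφ : φ ∈ IsManifold.maximalAtlas (𝓡 d) ∞ M) {p : M} (hp : p ∈ φ.source) {K : Set M}
    (hK : K ∈ 𝓝 p) :
    ∃ L > 0, ∃ δ > 0, ∀ᶠ q in 𝓝 p, IsGoodChart φ K q L δ := by
  obtain ⟨C, hC, hbd, V, hV, hlip⟩ := exists_bilipschitz_nhds hφ hp
  have hW : V ∩ (K ∩ φ.source) ∈ 𝓝 p :=
    Filter.inter_mem hV (Filter.inter_mem hK (φ.open_source.mem_nhds hp))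
  obtain ⟨R, hR, hRW⟩ := exists_rball_subset_of_mem_nhds hW
  have hW' : φ '' (V ∩ (K ∩ φ.source)) ∈ 𝓝 (φ p) := by
    rw [← φ.map_nhds_eq hp]
    exact Filter.image_mem_map hW
  obtain ⟨s, hs, hsW⟩ := Metric.mem_nhds_iff.mp hW'
  -- The first bound keeps balls about nearby `q` inside `rball p R`; the second keeps the
  -- coordinate balls inside `ball (φ p) s`, which the chart image covers.
  refine ⟨C, hC, min (R / 2) (C * (s / 2)), by positivity, ?_⟩
  have hs2 : φ ⁻¹' ball (φ p) (s / 2) ∈ 𝓝 p :=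
    (φ.continuousAt hp).preimage_mem_nhds (ball_mem_nhds _ (by positivity))
  filter_upwards [hbd, hs2, (isOpen_rball p (R / 2)).mem_nhds (mem_rball_self p (by positivity))]
    with q hq hqs hqR
  have hsub : rball q (min (R / 2) (C * (s / 2))) ⊆ V ∩ (K ∩ φ.source) :=
    (rball_subset_rball_of_mem hqR (by positivity) (by linarith [min_le_left (R / 2) (C * (s / 2))])
      : _ ⊆ rball p R).trans hRW
  have hqW := hsub (mem_rball_self q (by positivity))
  refine ⟨hsub.trans fun z hz => hz.2.1, fun a ha b hb => (hlip a (hsub ha).1 b (hsub hb).1).1,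
    fun a ha b hb => (hlip a (hsub ha).1 b (hsub hb).1).2, fun v => (hq v).1, fun v => (hq v).2,
    fun w hw => ?_⟩
  have hle : min (R / 2) (C * (s / 2)) / C ≤ s / 2 := by
    rw [div_le_iff₀ hC, mul_comm]; exact min_le_right _ _
  have hws : w ∈ ball (φ p) s := by
    rw [mem_ball] at hw ⊢
    calc dist w (φ p) ≤ dist w (φ q) + dist (φ q) (φ p) := dist_triangle _ _ _
      _ < s := by linarith [show dist (φ q) (φ p) < s / 2 from hqs]
  obtain ⟨a, ha, rfl⟩ := hsW hws
  exact ⟨a, mem_rball_of_edist_le hC (hlip a ha.1 q hqW.1).2 hw (by field_simp; rfl), rfl⟩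

/-- On a compact manifold, every point has a good chart, with uniform constants. -/
lemma exists_isGoodChart [CompactSpace M] (𝒜 : ChartSystem d M) :
    ∃ L > 0, ∃ δ > 0, ∀ q : M, ∃ k, IsGoodChart (𝒜.chart k) (𝒜.piece k) q L δ := by
  suffices h : ∃ L > 0, ∃ δ > 0, ∀ q ∈ (univ : Set M),
      ∃ k, IsGoodChart (𝒜.chart k) (𝒜.piece k) q L δ by simpa using h
  refine isCompact_univ.induction_on
    (p := fun U => ∃ L > 0, ∃ δ > 0, ∀ q ∈ U,
      ∃ k, IsGoodChart (𝒜.chart k) (𝒜.piece k) q L δ) ?_ ?_ ?_ ?_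
  · exact ⟨1, one_pos, 1, one_pos, by simp⟩
  · rintro U V hUV ⟨L, hL, δ, hδ, h⟩
    exact ⟨L, hL, δ, hδ, fun q hq => h q (hUV hq)⟩
  · rintro U V ⟨L, hL, δ, hδ, h⟩ ⟨L', hL', δ', hδ', h'⟩
    refine ⟨max L L', by positivity, min δ δ', by positivity, ?_⟩
    rintro q (hq | hq)
    · obtain ⟨k, hk⟩ := h q hq
      exact ⟨k, hk.mono hL (le_max_left _ _) (by positivity) (min_le_left _ _)⟩
    · obtain ⟨k, hk⟩ := h' q hq
      exact ⟨k, hk.mono hL' (le_max_right _ _) (by positivity) (min_le_right _ _)⟩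
  · intro p _
    obtain ⟨k, hk⟩ := mem_iUnion.mp (𝒜.cover ▸ mem_univ p)
    obtain ⟨L, hL, δ, hδ, h⟩ := exists_isGoodChart_nhds (𝒜.chart_mem k)
      (𝒜.piece_subset k (interior_subset hk)) (mem_interior_iff_mem_nhds.mp hk)
    exact ⟨_, mem_nhdsWithin_of_mem_nhds h, L, hL, δ, hδ, fun q hq => ⟨k, hq⟩⟩

end GoodCharts
-- Co-norms.
section Conorm

variable {V W : Type*} [NormedAddCommGroup V] [NormedSpace ℝ V]
  [NormedAddCommGroup W] [NormedSpace ℝ W]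

lemma conorm_nonneg (D : V →L[ℝ] W) : 0 ≤ conorm D :=
  Real.sInf_nonneg (by rintro _ ⟨v, -, rfl⟩; exact norm_nonneg _)

lemma conorm_mul_norm_le (D : V →L[ℝ] W) (v : V) : conorm D * ‖v‖ ≤ ‖D v‖ := by
  rcases eq_or_ne v 0 with rfl | hv
  · simp
  have hv' : 0 < ‖v‖ := norm_pos_iff.mpr hv
  have h : conorm D ≤ ‖D (‖v‖⁻¹ • v)‖ :=
    csInf_le ⟨0, by rintro _ ⟨v, -, rfl⟩; exact norm_nonneg _⟩
      ⟨_, by rw [norm_smul, norm_inv, norm_norm, inv_mul_cancel₀ hv'.ne'], rfl⟩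
  rwa [map_smul, norm_smul, norm_inv, norm_norm, inv_mul_eq_div, le_div_iff₀ hv'] at h

lemma le_conorm {D : V →L[ℝ] W} {c : ℝ} (hV : ∃ v : V, ‖v‖ = 1)
    (h : ∀ v : V, c * ‖v‖ ≤ ‖D v‖) : c ≤ conorm D := by
  obtain ⟨v, hv⟩ := hV
  refine le_csInf ⟨_, v, hv, rfl⟩ ?_
  rintro _ ⟨w, hw, rfl⟩
  simpa [hw] using h w

/-- Without unit vectors the infimum is over the empty set and equals `0`; thus expansion excludes
dimension zero. -/
lemma exists_norm_eq_one_of_conorm_pos {D : V →L[ℝ] W} (h : 0 < conorm D) :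
    ∃ v : V, ‖v‖ = 1 := by
  by_contra! hne
  have : {t : ℝ | ∃ v : V, ‖v‖ = 1 ∧ t = ‖D v‖} = ∅ := by
    ext t
    simp [hne]
  simp [conorm, this] at h

end Conorm

/-! ### Coordinate expressions, their derivatives and Lipschitz bounds. -/

section EucNorm

variable {d : ℕ} {α : ℝ≥0} {g : EuclideanSpace ℝ (Fin d) → EuclideanSpace ℝ (Fin d)}
  {S : Set (EuclideanSpace ℝ (Fin d))} {C : ℝ≥0}

lemma norm_fderiv_le_of_eucNorm_le (h : eucNorm α g S ≤ C) {y : EuclideanSpace ℝ (Fin d)}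
    (hy : y ∈ S) : ‖fderiv ℝ g y‖ ≤ C := by
  have h1 : ‖fderiv ℝ g y‖ₑ ≤ C := by
    refine le_trans ?_ h
    refine le_trans ?_ le_self_add
    exact (le_iSup₂ (f := fun y (_ : y ∈ S) => ‖fderiv ℝ g y‖ₑ) y hy).trans le_add_self
  exact_mod_cast enorm_le_coe.mp h1

lemma norm_fderiv_sub_le_of_eucNorm_le (h : eucNorm α g S ≤ C) {y z : EuclideanSpace ℝ (Fin d)}
    (hy : y ∈ S) (hz : z ∈ S) (hyz : ‖y - z‖ < 1) :
    ‖fderiv ℝ g y - fderiv ℝ g z‖ ≤ C * ‖y - z‖ ^ (α : ℝ) := by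
  rcases eq_or_ne y z with rfl | hne
  · simp only [sub_self, norm_zero]; positivity
  have hpos : 0 < ‖y - z‖ := norm_sub_pos_iff.mpr hne
  have h1 : ENNReal.ofReal (‖fderiv ℝ g y - fderiv ℝ g z‖ / ‖y - z‖ ^ (α : ℝ)) ≤ C := by
    refine le_trans ?_ (le_add_self.trans h)
    refine le_iSup₂_of_le y hy (le_iSup₂_of_le z hz ?_)
    exact le_iSup_of_le ⟨hpos, hyz⟩ le_rfl
  rw [← ENNReal.ofReal_coe_nnreal] at h1
  replace h1 := (ENNReal.ofReal_le_ofReal_iff C.coe_nonneg).mp h1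
  rwa [div_le_iff₀ (by positivity)] at h1

end EucNorm

section CoordinateExpressions

open Manifold Metric

variable {d : ℕ} {M : Type*} [TopologicalSpace M] [ChartedSpace (EuclideanSpace ℝ (Fin d)) M]

/-- The expression of a map in two charts. -/
def coordExpr (φ φ' : OpenPartialHomeomorph M (EuclideanSpace ℝ (Fin d))) (f : M → M) :
    EuclideanSpace ℝ (Fin d) → EuclideanSpace ℝ (Fin d) :=
  fun y => φ' (f (φ.symm y))

variable {α : ℝ≥0} (f : LocDiffeo d M α)
  {φ φ' : OpenPartialHomeomorph M (EuclideanSpace ℝ (Fin d))} {p : M}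

lemma LocDiffeo.mdifferentiableAt (hp : p ∈ f.source) :
    MDifferentiableAt (𝓡 d) (𝓡 d) f.toOpenPartialHomeomorph p :=
  (f.isCOneHolderOn_toFun.1.mdifferentiableOn one_ne_zero).mdifferentiableAt
    (f.open_source.mem_nhds hp)

lemma mdifferentiableAt_of_mem_maximalAtlas (hφ : φ ∈ IsManifold.maximalAtlas (𝓡 d) ∞ M)
    (hp : p ∈ φ.source) : MDifferentiableAt (𝓡 d) (𝓡 d) φ p :=
  ((contMDiffOn_of_mem_maximalAtlas hφ).mdifferentiableOn (by simp)).mdifferentiableAt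
    (φ.open_source.mem_nhds hp)

lemma differentiableAt_coordExpr (hφ : φ ∈ IsManifold.maximalAtlas (𝓡 d) ∞ M)
    (hφ' : φ' ∈ IsManifold.maximalAtlas (𝓡 d) ∞ M) (hpf : p ∈ f.source) (hp : p ∈ φ.source)
    (hp' : f.toOpenPartialHomeomorph p ∈ φ'.source) :
    DifferentiableAt ℝ (coordExpr φ φ' f.toOpenPartialHomeomorph) (φ p) := by
  rw [← mdifferentiableAt_iff_differentiableAt]
  have h1 : MDifferentiableAt (𝓡 d) (𝓡 d) φ.symm (φ p) :=
    ((contMDiffOn_symm_of_mem_maximalAtlas hφ).mdifferentiableOn (by simp)).mdifferentiableAt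
      (φ.open_target.mem_nhds (φ.map_source hp))
  refine MDifferentiableAt.comp (I' := 𝓡 d) (φ p) (g := φ')
    (f := f.toOpenPartialHomeomorph ∘ φ.symm) ?_
    (MDifferentiableAt.comp (I' := 𝓡 d) (φ p) ?_ h1)
  · simpa [φ.left_inv hp] using mdifferentiableAt_of_mem_maximalAtlas hφ' hp'
  · simpa [φ.left_inv hp] using f.mdifferentiableAt hpf

lemma fderiv_coordExpr_chartDeriv (hφ : φ ∈ IsManifold.maximalAtlas (𝓡 d) ∞ M)
    (hφ' : φ' ∈ IsManifold.maximalAtlas (𝓡 d) ∞ M) (hpf : p ∈ f.source) (hp : p ∈ φ.source)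
    (hp' : f.toOpenPartialHomeomorph p ∈ φ'.source) (v : TangentSpace (𝓡 d) p) :
    fderiv ℝ (coordExpr φ φ' f.toOpenPartialHomeomorph) (φ p) (chartDeriv φ p v) =
      chartDeriv φ' (f.toOpenPartialHomeomorph p)
        (mfderiv (𝓡 d) (𝓡 d) f.toOpenPartialHomeomorph p v) := by
  rw [← chartDeriv_comp (differentiableAt_coordExpr f hφ hφ' hpf hp hp')
    (mdifferentiableAt_of_mem_maximalAtlas hφ hp),
    ← chartDeriv_comp_mfderiv (mdifferentiableAt_of_mem_maximalAtlas hφ' hp')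
      (f.mdifferentiableAt hpf)]
  refine chartDeriv_congr ?_ v
  filter_upwards [φ.open_source.mem_nhds hp] with a ha
  simp [coordExpr, φ.left_inv ha]

lemma eucNorm_coordExpr_le {𝒜 : ChartSystem d M} {C : ℝ≥0} (hC : cOneHolderNorm 𝒜 f ≤ C)
    (k l : Fin 𝒜.card) :
    eucNorm α (coordExpr (𝒜.chart k) (𝒜.chart l) f.toOpenPartialHomeomorph)
      (𝒜.chart k '' (𝒜.piece k ∩ f.source ∩ f.toOpenPartialHomeomorph ⁻¹' 𝒜.piece l)) ≤ C :=
  (le_iSup₂ (f := fun k l => eucNorm α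
    (fun y => 𝒜.chart l (f.toOpenPartialHomeomorph ((𝒜.chart k).symm y)))
    (𝒜.chart k '' (𝒜.piece k ∩ f.source ∩ f.toOpenPartialHomeomorph ⁻¹' 𝒜.piece l))) k l).trans hC

/-- In good charts, a map with bounded `C^{1+α}` norm is Hölder-close to its derivative. -/
lemma approximatesLinearOn_coordExpr {𝒜 : ChartSystem d M} {C : ℝ≥0}
    (hC : cOneHolderNorm 𝒜 f ≤ C) {k l : Fin 𝒜.card} {U : Set M} {s : ℝ} (hs : 0 < s) (hs1 : s < 1)
    (hU : U ⊆ 𝒜.piece k ∩ f.source ∩ f.toOpenPartialHomeomorph ⁻¹' 𝒜.piece l)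
    (hsU : closedBall (𝒜.chart k p) s ⊆ 𝒜.chart k '' U) :
    ApproximatesLinearOn (coordExpr (𝒜.chart k) (𝒜.chart l) f.toOpenPartialHomeomorph)
      (fderiv ℝ (coordExpr (𝒜.chart k) (𝒜.chart l) f.toOpenPartialHomeomorph) (𝒜.chart k p))
      (closedBall (𝒜.chart k p) s) (C * s ^ (α : ℝ)).toNNReal := by
  intro y hy z hz
  have hn := eucNorm_coordExpr_le f hC k l
  have hcc := mem_closedBall_self (x := 𝒜.chart k p) hs.le
  rw [Real.coe_toNNReal _ (by positivity)]
  refine (convex_closedBall (𝒜.chart k p) s).norm_image_sub_le_of_norm_hasFDerivWithin_le'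
    (f' := fderiv ℝ (coordExpr (𝒜.chart k) (𝒜.chart l) f.toOpenPartialHomeomorph))
    (fun w hw => ?_) (fun w hw => ?_) hz hy
  · obtain ⟨a, ha, rfl⟩ := hsU hw
    obtain ⟨⟨ha₁, ha₂⟩, ha₃⟩ := hU ha
    exact (differentiableAt_coordExpr f (𝒜.chart_mem k) (𝒜.chart_mem l) ha₂
      (𝒜.piece_subset k ha₁) (𝒜.piece_subset l ha₃)).hasFDerivAt.hasFDerivWithinAt
  · rw [mem_closedBall, dist_eq_norm] at hw
    refine (norm_fderiv_sub_le_of_eucNorm_le hn (image_mono hU (hsU (by simpa [dist_eq_norm]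
      using hw))) (image_mono hU (hsU hcc)) (hw.trans_lt hs1)).trans ?_
    gcongr

end CoordinateExpressions

section Lipschitz

open Manifold Metric

variable {d : ℕ} {M : Type*} [EMetricSpace M] [ChartedSpace (EuclideanSpace ℝ (Fin d)) M]
  [RiemannianBundle (fun x : M => TangentSpace (𝓡 d) x)]

/-- Each of the two charts costs a factor `L`. The bound holds on all of the domain, not only on the
orbit, so it can be integrated along paths. -/
lemma norm_mfderiv_le_of_isGoodChart {𝒜 : ChartSystem d M} {L δ : ℝ} (hL : 0 < L) (hδ : 0 < δ)
    (hgood : ∀ q : M, ∃ k, IsGoodChart (𝒜.chart k) (𝒜.piece k) q L δ) {α C : ℝ≥0}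
    {f : LocDiffeo d M α} (hC : cOneHolderNorm 𝒜 f ≤ C) {p : M} (hp : p ∈ f.source)
    (v : TangentSpace (𝓡 d) p) :
    ‖mfderiv (𝓡 d) (𝓡 d) f.toOpenPartialHomeomorph p v‖ ≤ L * (C * (L * ‖v‖)) := by
  obtain ⟨k, hk⟩ := hgood p
  obtain ⟨l, hl⟩ := hgood (f.toOpenPartialHomeomorph p)
  have hpk := hk.ball_subset (mem_rball_self p hδ)
  have hpl := hl.ball_subset (mem_rball_self _ hδ)
  refine (hl.le_deriv _).trans (mul_le_mul_of_nonneg_left ?_ hL.le)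
  rw [← fderiv_coordExpr_chartDeriv f (𝒜.chart_mem k) (𝒜.chart_mem l) hp
    (𝒜.piece_subset k hpk) (𝒜.piece_subset l hpl)]
  refine (ContinuousLinearMap.le_opNorm _ _).trans ?_
  exact mul_le_mul (norm_fderiv_le_of_eucNorm_le (eucNorm_coordExpr_le f hC k l)
    ⟨p, ⟨⟨hpk, hp⟩, hpl⟩, rfl⟩) (hk.deriv_le v) (norm_nonneg _) C.2

variable [IsRiemannianManifold (𝓡 d) M]

lemma mem_rball_of_norm_mfderiv_le {α : ℝ≥0} {f : LocDiffeo d M α} {Λ δ δ' : ℝ} (hΛ : 0 < Λ)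
    (hf : ∀ p ∈ f.source, ∀ v : TangentSpace (𝓡 d) p,
      ‖mfderiv (𝓡 d) (𝓡 d) f.toOpenPartialHomeomorph p v‖ ≤ Λ * ‖v‖)
    {y z : M} (hy : rball y δ ⊆ f.source) (hz : z ∈ rball y δ) (hδ : Λ * δ ≤ δ') :
    f.toOpenPartialHomeomorph z ∈ rball (f.toOpenPartialHomeomorph y) δ' := by
  have h : edist (f.toOpenPartialHomeomorph y) (f.toOpenPartialHomeomorph z) ≤
      Λ.toNNReal * edist y z :=
    edist_le_mul_edist_of_enorm_mfderiv_le (I := 𝓡 d) (I' := 𝓡 d)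
      (f.isCOneHolderOn_toFun.1.mono hy)
      (fun p hp v => enorm_le_toNNReal_mul_enorm hΛ.le (hf p (hy hp) v)) hz
  rw [edist_comm, edist_comm y z] at h
  refine h.trans_lt ?_
  calc (Λ.toNNReal : ℝ≥0∞) * edist z y < Λ.toNNReal * ENNReal.ofReal δ := by
        refine (ENNReal.mul_lt_mul_iff_right ?_ ENNReal.coe_ne_top).mpr hz
        simpa using hΛ
    _ = ENNReal.ofReal (Λ * δ) := (ENNReal.ofReal_mul hΛ.le).symm
    _ ≤ _ := ENNReal.ofReal_le_ofReal hδ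

end Lipschitz

/-! ### Derivatives of the compositions along the orbit. -/

section Orbit

open Manifold Metric

variable {d : ℕ} {M : Type*} [TopologicalSpace M] [ChartedSpace (EuclideanSpace ℝ (Fin d)) M]
  {α : ℝ≥0} {f : ℕ → LocDiffeo d M α} {x : M}

lemma mdifferentiableAt_seqComp (h : ∀ n, seqComp f n x ∈ (f n).source) (n : ℕ) :
    MDifferentiableAt (𝓡 d) (𝓡 d) (seqComp f n) x := by
  induction n with
  | zero => exact mdifferentiableAt_id
  | succ n ih => exact ((f n).mdifferentiableAt (h n)).comp x ih

lemma mfderiv_seqComp_zero_apply (v : TangentSpace (𝓡 d) x) :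
    mfderiv (𝓡 d) (𝓡 d) (seqComp f 0) x v = v := by
  change mfderiv (𝓡 d) (𝓡 d) (id : M → M) x v = v
  rw [mfderiv_id]
  rfl

lemma mfderiv_seqComp_succ_apply (h : ∀ n, seqComp f n x ∈ (f n).source) (n : ℕ)
    (v : TangentSpace (𝓡 d) x) :
    mfderiv (𝓡 d) (𝓡 d) (seqComp f (n + 1)) x v =
      mfderiv (𝓡 d) (𝓡 d) (f n).toOpenPartialHomeomorph (seqComp f n x)
        (mfderiv (𝓡 d) (𝓡 d) (seqComp f n) x v) :=
  congr($(mfderiv_comp (I := 𝓡 d) (I' := 𝓡 d) (I'' := 𝓡 d) x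
    ((f n).mdifferentiableAt (h n)) (mdifferentiableAt_seqComp h n)) v)

/-- The products of the linear maps `D 0, D 1, …`. -/
noncomputable def linearOrbit {E : Type*} [NormedAddCommGroup E] [NormedSpace ℝ E]
    (D : ℕ → E →L[ℝ] E) : ℕ → E →L[ℝ] E
  | 0 => ContinuousLinearMap.id ℝ E
  | n + 1 => D n ∘L linearOrbit D n

variable {φ : ℕ → OpenPartialHomeomorph M (EuclideanSpace ℝ (Fin d))}

/-- Chain rule: the intermediate charts cancel, so the coordinate products are the derivative of
`f^n` read in the first and last charts. -/
lemma linearOrbit_chartDeriv (h : ∀ n, seqComp f n x ∈ (f n).source)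
    (hφ : ∀ n, φ n ∈ IsManifold.maximalAtlas (𝓡 d) ∞ M)
    (hx : ∀ n, seqComp f n x ∈ (φ n).source) (n : ℕ) (v : TangentSpace (𝓡 d) x) :
    linearOrbit (fun n => fderiv ℝ (coordExpr (φ n) (φ (n + 1)) (f n).toOpenPartialHomeomorph)
      (φ n (seqComp f n x))) n (chartDeriv (φ 0) x v) =
      chartDeriv (φ n) (seqComp f n x) (mfderiv (𝓡 d) (𝓡 d) (seqComp f n) x v) := by
  induction n with
  | zero =>
    rw [mfderiv_seqComp_zero_apply]
    rfl
  | succ n ih =>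
    rw [linearOrbit, ContinuousLinearMap.comp_apply, ih, mfderiv_seqComp_succ_apply h]
    exact fderiv_coordExpr_chartDeriv (f n) (hφ n) (hφ (n + 1)) (h n) (hx n) (hx (n + 1)) _

variable [RiemannianBundle (fun x : M => TangentSpace (𝓡 d) x)]

lemma one_le_conorm_mfderiv_seqComp_zero (hV : ∃ v : TangentSpace (𝓡 d) x, ‖v‖ = 1) :
    1 ≤ conorm (mfderiv (𝓡 d) (𝓡 d) (seqComp f 0) x) := by
  refine le_conorm hV fun v => ?_
  rw [mfderiv_seqComp_zero_apply, one_mul]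
  rfl

lemma mul_conorm_mfderiv_seqComp_le (h : ∀ n, seqComp f n x ∈ (f n).source)
    (hV : ∃ v : TangentSpace (𝓡 d) x, ‖v‖ = 1) {η : ℝ} (n : ℕ)
    (hexp : η ≤ conorm (mfderiv (𝓡 d) (𝓡 d) (f n).toOpenPartialHomeomorph
      (seqComp f n x))) :
    η * conorm (mfderiv (𝓡 d) (𝓡 d) (seqComp f n) x) ≤
      conorm (mfderiv (𝓡 d) (𝓡 d) (seqComp f (n + 1)) x) := by
  refine le_conorm hV fun v => ?_
  rw [mfderiv_seqComp_succ_apply h, mul_assoc]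
  refine le_trans ?_ (conorm_mul_norm_le _ _)
  exact mul_le_mul hexp (conorm_mul_norm_le _ v)
    (mul_nonneg (conorm_nonneg _) (norm_nonneg _)) (conorm_nonneg _)

lemma norm_mfderiv_seqComp_le {κ : ℝ} (hκ : 1 ≤ κ)
    (hconf : ∀ n, 1 ≤ n → IsConformalWith κ (mfderiv (𝓡 d) (𝓡 d) (seqComp f n) x))
    (hV : ∃ v : TangentSpace (𝓡 d) x, ‖v‖ = 1) (n : ℕ) (v : TangentSpace (𝓡 d) x) :
    ‖mfderiv (𝓡 d) (𝓡 d) (seqComp f n) x v‖ ≤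
      κ * conorm (mfderiv (𝓡 d) (𝓡 d) (seqComp f n) x) * ‖v‖ := by
  rcases Nat.eq_zero_or_pos n with rfl | hn
  · rw [mfderiv_seqComp_zero_apply]
    exact le_mul_of_one_le_left (norm_nonneg v)
      (one_le_mul_of_one_le_of_one_le hκ (one_le_conorm_mfderiv_seqComp_zero hV))
  · exact (ContinuousLinearMap.le_opNorm _ v).trans
      (mul_le_mul_of_nonneg_right (hconf n hn) (norm_nonneg v))

end Orbit

/-! ### Transfer between manifold and coordinates, and the theorem. -/

section Coordinates

open Manifold Metric

variable {d : ℕ} {M : Type*} [EMetricSpace M] [ChartedSpace (EuclideanSpace ℝ (Fin d)) M]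
  [RiemannianBundle (fun x : M => TangentSpace (𝓡 d) x)]
  {φ : OpenPartialHomeomorph M (EuclideanSpace ℝ (Fin d))} {K : Set M} {q : M} {L δ : ℝ}

lemma IsGoodChart.chartDeriv_surjective (h : IsGoodChart φ K q L δ) :
    Function.Surjective (chartDeriv (d := d) φ q) := by
  have hinj : Function.Injective (chartDeriv (d := d) φ q) := by
    rw [injective_iff_map_eq_zero]
    intro v hv
    have := h.le_deriv v
    rw [hv, norm_zero, mul_zero] at this
    exact norm_le_zero_iff.mp this
  have : FiniteDimensional ℝ (TangentSpace (𝓡 d) q) :=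
    inferInstanceAs (FiniteDimensional ℝ (EuclideanSpace ℝ (Fin d)))
  exact (LinearMap.injective_iff_surjective_of_finrank_eq_finrank rfl).mp hinj

lemma IsGoodChart.dist_lt (h : IsGoodChart φ K q L δ) (hL : 0 < L) {a : M} {r : ℝ}
    (hr : r ≤ δ) (ha : a ∈ rball q r) : dist (φ a) (φ q) < L * r := by
  have hr0 : 0 < r := by
    by_contra! hr
    simp [rball, ENNReal.ofReal_of_nonpos hr] at ha
  have h1 := h.edist_le a (rball_subset_rball hr ha) q (mem_rball_self q (hr0.trans_le hr))
  have h2 : ENNReal.ofReal L * edist a q < ENNReal.ofReal L * ENNReal.ofReal r :=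
    (ENNReal.mul_lt_mul_iff_right (by simpa using hL) ENNReal.ofReal_ne_top).mpr ha
  rw [← ENNReal.ofReal_mul hL.le] at h2
  have h3 := h1.trans_lt h2
  rw [edist_dist] at h3
  exact (ENNReal.ofReal_lt_ofReal_iff (by positivity)).mp h3

lemma IsGoodChart.injOn (h : IsGoodChart φ K q L δ) : InjOn φ (rball q δ) := by
  intro a ha b hb hab
  have := h.le_edist a ha b hb
  rw [hab, edist_self, mul_zero] at this
  exact edist_le_zero.mp this

end Coordinates

end ControlGeometry

theorem mainTheorem9 {d : ℕ} {M : Type*} [EMetricSpace M] [CompactSpace M]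
    [ChartedSpace (EuclideanSpace ℝ (Fin d)) M] [IsManifold (𝓡 d) ∞ M]
    [RiemannianBundle (fun x : M => TangentSpace (𝓡 d) x)]
    [IsContMDiffRiemannianBundle (𝓡 d) ∞ (EuclideanSpace ℝ (Fin d))
      (fun x : M => TangentSpace (𝓡 d) x)]
    [IsRiemannianManifold (𝓡 d) M]
    (𝒜 : ControlGeometry.ChartSystem d M)
    (α : ℝ≥0) (hα0 : 0 < α) (hα1 : α ≤ 1)
    (f : ℕ → ControlGeometry.LocDiffeo d M α)
    (hbound : ControlGeometry.HasBoundedNorm 𝒜 f)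
    (x : M) (ρ : ℝ) (hρ : 0 < ρ)
    (hdom : ∀ n : ℕ, ControlGeometry.rball (ControlGeometry.seqComp f n x) ρ ⊆ (f n).source)
    (hconf : ControlGeometry.IsQuasiConformalAt f x)
    (hexp : ControlGeometry.IsExpandingAt f x) :
    ∃ ξ₀ : ℝ, 0 < ξ₀ ∧ ∃ θ : ℝ, 1 < θ ∧
      ∀ ξ : ℝ, 0 < ξ → ξ ≤ ξ₀ → ∀ n : ℕ, ∃ r : ℝ, 0 < r ∧
        ControlGeometry.rball x (θ * r) ⊆ (ControlGeometry.seqComp f n).source ∧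
        ControlGeometry.seqComp f n '' ControlGeometry.rball x r ⊆
          ControlGeometry.rball (ControlGeometry.seqComp f n x) ξ ∧
        ControlGeometry.rball (ControlGeometry.seqComp f n x) ξ ⊆
          ControlGeometry.seqComp f n '' ControlGeometry.rball x (θ * r) := by
  open ControlGeometry Metric in
  obtain ⟨C, hC⟩ := hbound
  obtain ⟨κ, hκ, hconf⟩ := hconf
  obtain ⟨η, hη, hexp⟩ := hexp
  have horb : ∀ n, seqComp f n x ∈ (f n).source := fun n => (hexp n).1
  -- uniform good charts along the orbit
  obtain ⟨L, hL1, δ, hδ, hgood⟩ : ∃ L, 1 ≤ L ∧ ∃ δ > 0, ∀ q : M, ∃ k,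
      IsGoodChart (𝒜.chart k) (𝒜.piece k) q L δ := by
    obtain ⟨L, hL, δ, hδ, h⟩ := exists_isGoodChart 𝒜
    refine ⟨max L 1, le_max_right _ _, δ, hδ, fun q => ?_⟩
    obtain ⟨k, hk⟩ := h q
    exact ⟨k, hk.mono hL (le_max_left _ _) hδ le_rfl⟩
  have hL : 0 < L := one_pos.trans_le hL1
  choose k hk using fun n => hgood (seqComp f n x)
  let φ : ℕ → OpenPartialHomeomorph M (EuclideanSpace ℝ (Fin d)) := fun n => 𝒜.chart (k n)
  have hφ : ∀ n, φ n ∈ IsManifold.maximalAtlas (𝓡 d) ∞ M := fun n => 𝒜.chart_mem (k n)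
  have hsrc : ∀ n, rball (seqComp f n x) δ ⊆ (φ n).source := fun n =>
    (hk n).ball_subset.trans (𝒜.piece_subset _)
  have hx : ∀ n, seqComp f n x ∈ (φ n).source := fun n => hsrc n (mem_rball_self _ hδ)
  -- a uniform Lipschitz bound
  set Λ : ℝ := L * C * L + 1 with hΛ
  have hΛ0 : 0 < Λ := by positivity
  have hlip : ∀ n, ∀ p ∈ (f n).source, ∀ v : TangentSpace (𝓡 d) p,
      ‖mfderiv (𝓡 d) (𝓡 d) (f n).toOpenPartialHomeomorph p v‖ ≤ Λ * ‖v‖ := fun n p hp v => by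
    refine (norm_mfderiv_le_of_isGoodChart hL hδ hgood (hC n) hp v).trans ?_
    nlinarith [norm_nonneg v]
  -- On balls of radius `δ₀` the next map is defined and its image stays in the next good chart
  -- ball, so coordinate expressions make sense.
  obtain ⟨δ₀, hδ₀, hδ₀δ, hδ₀ρ, hδ₀Λ⟩ : ∃ δ₀ > 0, δ₀ ≤ δ ∧ δ₀ ≤ ρ ∧ Λ * δ₀ ≤ δ := by
    refine ⟨min (min δ ρ) (δ / Λ), by positivity, (min_le_left _ _).trans (min_le_left _ _),
      (min_le_left _ _).trans (min_le_right _ _), ?_⟩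
    rw [← le_div_iff₀' hΛ0]
    exact min_le_right _ _
  have hk₀ : ∀ n, IsGoodChart (φ n) (𝒜.piece (k n)) (seqComp f n x) L δ₀ := fun n =>
    (hk n).mono hL le_rfl hδ₀ hδ₀δ
  have hdom₀ : ∀ n, rball (seqComp f n x) δ₀ ⊆ (f n).source := fun n =>
    (rball_subset_rball hδ₀ρ).trans (hdom n)
  have hmaps : ∀ n, ∀ y ∈ rball (seqComp f n x) δ₀,
      (f n).toOpenPartialHomeomorph y ∈ rball (seqComp f (n + 1) x) δ := fun n y hy =>
    mem_rball_of_norm_mfderiv_le hΛ0 (hlip n) (hdom₀ n) hy hδ₀Λ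
  -- derivatives along the orbit
  have hV : ∃ v : TangentSpace (𝓡 d) x, ‖v‖ = 1 :=
    exists_norm_eq_one_of_conorm_pos ((zero_lt_one.trans hη).trans (hexp 0).2)
  let b : ℕ → ℝ := fun n => conorm (mfderiv (𝓡 d) (𝓡 d) (seqComp f n) x)
  have hb : ∀ n, η * b n ≤ b (n + 1) := fun n =>
    mul_conorm_mfderiv_seqComp_le horb hV n (hexp n).2.le
  have hb1 : ∀ n, 1 ≤ b n := fun n => by
    induction n with
    | zero => exact one_le_conorm_mfderiv_seqComp_zero hV
    | succ n ih => nlinarith [hb n]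
  have hb0 : ∀ n, 0 < b n := fun n => one_pos.trans_le (hb1 n)
  let g : ℕ → EuclideanSpace ℝ (Fin d) → EuclideanSpace ℝ (Fin d) := fun n =>
    coordExpr (φ n) (φ (n + 1)) (f n).toOpenPartialHomeomorph
  let c : ℕ → EuclideanSpace ℝ (Fin d) := fun n => φ n (seqComp f n x)
  let D : ℕ → EuclideanSpace ℝ (Fin d) →L[ℝ] EuclideanSpace ℝ (Fin d) := fun n =>
    fderiv ℝ (g n) (c n)
  have hg : ∀ n, ∀ y ∈ (φ n).source,
      g n (φ n y) = φ (n + 1) ((f n).toOpenPartialHomeomorph y) := fun n y hy => by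
    simp only [g, coordExpr, (φ n).left_inv hy]
  have hA : ∀ n (v : TangentSpace (𝓡 d) x), linearOrbit D n (chartDeriv (φ 0) x v) =
      chartDeriv (φ n) (seqComp f n x) (mfderiv (𝓡 d) (𝓡 d) (seqComp f n) x v) :=
    linearOrbit_chartDeriv horb hφ hx
  -- One factor `L` for each of the first and last charts, and `κ` for the distortion of `f^n`.
  set H : ℝ := κ * L ^ 2 with hH
  have hH1 : 1 ≤ H := one_le_mul_of_one_le_of_one_le hκ (one_le_pow₀ hL1)
  have hH0 : 0 < H := one_pos.trans_le hH1
  have hDf := norm_mfderiv_seqComp_le hκ (fun n hn => (hconf n hn).2) hV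
  have hk_zero : IsGoodChart (φ 0) (𝒜.piece (k 0)) x L δ := hk 0
  have hAu : ∀ n u, ‖linearOrbit D n u‖ ≤ H * b n * ‖u‖ := fun n u => by
    obtain ⟨v, rfl⟩ := hk_zero.chartDeriv_surjective u
    rw [hA]
    calc _ ≤ L * (κ * b n * ‖v‖) :=
          ((hk n).deriv_le _).trans (mul_le_mul_of_nonneg_left (hDf n v) hL.le)
      _ ≤ L * (κ * b n * (L * ‖chartDeriv (φ 0) x v‖)) := by
          have := hb0 n
          gcongr
          exact hk_zero.le_deriv v
      _ = _ := by rw [hH]; ring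
  have hAl : ∀ n u, b n * ‖u‖ ≤ H * ‖linearOrbit D n u‖ := fun n u => by
    obtain ⟨v, rfl⟩ := hk_zero.chartDeriv_surjective u
    rw [hA]
    calc b n * ‖chartDeriv (φ 0) x v‖ ≤ b n * (L * ‖v‖) :=
          mul_le_mul_of_nonneg_left (hk_zero.deriv_le v) (hb0 n).le
      _ = L * (b n * ‖v‖) := by ring
      _ ≤ L * (L * ‖chartDeriv (φ n) (seqComp f n x)
            (mfderiv (𝓡 d) (𝓡 d) (seqComp f n) x v)‖) :=
          mul_le_mul_of_nonneg_left ((conorm_mul_norm_le _ v).trans ((hk n).le_deriv _)) hL.le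
      _ ≤ κ * (L * (L * ‖chartDeriv (φ n) (seqComp f n x)
            (mfderiv (𝓡 d) (𝓡 d) (seqComp f n) x v)‖)) :=
          le_mul_of_one_le_left (by positivity) hκ
      _ = _ := by rw [hH]; ring
  have hs₀ : 0 < min (δ₀ / L) 1 := by positivity
  obtain ⟨τ, hτ, hctrl⟩ := exists_orbit_control g c D (linearOrbit D) b (C := C) (H := H) (η := η)
    (s₀ := min (δ₀ / L) 1) (α := α) (by exact_mod_cast hα0) hη hs₀ C.2 hH0 rfl (fun _ => rfl)
    (fun n => hg n _ (hx n)) hb0 hb hAu hAl (fun n s hs hs₁ => by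
      refine approximatesLinearOn_coordExpr (f n) (hC n) (U := rball (seqComp f n x) δ₀) hs
        (hs₁.trans_le (min_le_right _ _)) ?_ ?_
      · exact fun y hy => ⟨⟨(hk₀ n).ball_subset hy, hdom₀ n hy⟩,
          (hk (n + 1)).ball_subset (hmaps n y hy)⟩
      · exact (closedBall_subset_ball (hs₁.trans_le (min_le_left _ _))).trans
          (hk₀ n).ball_subset_image)
  -- orbits in the manifold and in coordinates
  have htrack : ∀ N t, 0 < t → t * b N ≤ τ → ∀ y ∈ rball x δ₀, dist (φ 0 y) (c 0) ≤ t →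
      ∀ n ≤ N, y ∈ (seqComp f n).source ∧ seqComp f n y ∈ rball (seqComp f n x) δ₀ ∧
        φ n (seqComp f n y) = orbit g (φ 0 y) n := by
    intro N t ht htN y hy hyt n hn
    induction n with
    | zero => exact ⟨mem_univ y, hy, rfl⟩
    | succ n ih =>
      obtain ⟨h₁, h₂, h₃⟩ := ih (by omega)
      have h₄ : φ (n + 1) (seqComp f (n + 1) y) = orbit g (φ 0 y) (n + 1) := by
        rw [orbit, ← h₃, hg n _ (hsrc n (rball_subset_rball hδ₀δ h₂))]
        rfl
      refine ⟨⟨h₁, hdom₀ n h₂⟩, ?_, h₄⟩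
      have h₅ := ((hctrl N t ht htN).1 (φ 0 y) (by rwa [← dist_eq_norm]) (n + 1) hn).1
      rw [← h₄, ← dist_eq_norm] at h₅
      exact mem_rball_of_edist_le hL ((hk (n + 1)).le_edist _ (hmaps n _ h₂) _
        (mem_rball_self _ hδ)) (h₅.trans_le (min_le_left _ _)) (by field_simp; rfl)
  -- Covering needs coordinate radius `2 * H * L * ξ / b N`, hence radius `2 * H * L ^ 2 * ξ / b N =
  -- 6 * L ^ 4 * H ^ 2 * r` in `M` for the `r` below; `7` makes the inequality strict.
  set θ : ℝ := 7 * L ^ 4 * H ^ 2 with hθ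
  have hθ1 : 1 < θ := by
    have : 1 ≤ L ^ 4 * H ^ 2 :=
      one_le_mul_of_one_le_of_one_le (one_le_pow₀ hL1) (one_le_pow₀ hH1)
    linarith
  -- The two bounds ensure `θ * r ≤ δ₀` and `L * (θ * r) * b N ≤ τ`.
  refine ⟨min (δ₀ / (3 * L ^ 2 * H)) (τ / (3 * L ^ 3 * H)), by positivity, θ, hθ1,
    fun ξ hξ hξ₀ N => ?_⟩
  have hξδ := hξ₀.trans (min_le_left _ _)
  have hξτ := hξ₀.trans (min_le_right _ _)
  rw [le_div_iff₀ (by positivity)] at hξδ hξτ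
  have hbN := hb0 N
  -- Coordinate radius `L * r` grows to at most `2 * H * b N * (L * r) = 2 / 3 * (ξ / L)`, leaving
  -- room for the last chart.
  set r : ℝ := ξ / (3 * L ^ 2 * H * b N) with hr
  have hr0 : 0 < r := by positivity
  have hrb : r * b N = ξ / (3 * L ^ 2 * H) := by rw [hr]; field_simp
  have hθrb : θ * r * b N = 7 / 3 * (L ^ 2 * H * ξ) := by rw [hθ, hr]; field_simp
  have hθr : θ * r ≤ δ₀ := by
    have h1 : θ * r ≤ θ * r * b N := le_mul_of_one_le_right (by positivity) (hb1 N)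
    have h2 : 0 < L ^ 2 * H * ξ := by positivity
    linarith
  have hrθ : r ≤ θ * r := le_mul_of_one_le_left hr0.le hθ1.le
  have htb : L * (θ * r) * b N ≤ τ := by
    have h1 : L * (θ * r) * b N = 7 / 3 * (L ^ 3 * H * ξ) := by
      rw [mul_assoc, hθrb]; ring
    have h2 : 0 < L ^ 3 * H * ξ := by positivity
    linarith
  refine ⟨r, hr0, fun y hy => ?_, ?_, fun z hz => ?_⟩
  · exact (htrack N _ (by positivity) htb y (rball_subset_rball hθr hy)
      ((hk₀ 0).dist_lt hL hθr hy).le N le_rfl).1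
  · rintro _ ⟨y, hy, rfl⟩
    have hyd := (hk₀ 0).dist_lt hL (hrθ.trans hθr) hy
    have htb' : L * r * b N ≤ τ := le_trans (by gcongr) htb
    obtain ⟨-, h₂, h₃⟩ := htrack N (L * r) (by positivity) htb' y
      (rball_subset_rball (hrθ.trans hθr) hy) hyd.le N le_rfl
    have h₄ := ((hctrl N _ (by positivity) htb').1 (φ 0 y)
      (by rw [← dist_eq_norm]; exact hyd.le) N le_rfl).2
    rw [← h₃, ← dist_eq_norm] at h₄
    refine mem_rball_of_edist_le hL ((hk₀ N).le_edist _ h₂ _ (mem_rball_self _ hδ₀))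
      (r := ξ / L) (h₄.trans_lt ?_) (by field_simp; rfl)
    have h₅ : 2 * H * b N * (L * r) = 2 / 3 * (ξ / L) := by
      rw [hr]; field_simp
    have h₆ : 0 < ξ / L := by positivity
    linarith
  · have hξδ₀ : ξ ≤ δ₀ := by
      have : 1 ≤ L ^ 2 * H := one_le_mul_of_one_le_of_one_le (one_le_pow₀ hL1) hH1
      nlinarith
    have hzd := (hk₀ N).dist_lt hL hξδ₀ hz
    have ht0 : 0 < 2 * H * L * ξ / b N := by positivity
    have htb' : 2 * H * L * ξ / b N * b N ≤ τ := by
      rw [div_mul_cancel₀ _ hbN.ne']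
      have h1 : L ≤ L ^ 3 := le_self_pow₀ hL1 (by norm_num)
      have h2 : L * (H * ξ) ≤ L ^ 3 * (H * ξ) := by gcongr
      have h3 : 0 < L * (H * ξ) := by positivity
      linarith
    obtain ⟨w, hw, hwN⟩ := (hctrl N _ ht0 htb').2 (φ N z) (by
      rw [div_mul_cancel₀ _ hbN.ne', ← dist_eq_norm, mul_assoc (2 * H)]
      exact mul_le_mul_of_nonneg_left hzd.le (by positivity))
    -- Time `0` of the control places `w` in the image of the first chart ball, so it comes from a
    -- point `y` of `M`.
    have hw₀ := ((hctrl N _ ht0 htb').1 w hw 0 (Nat.zero_le N)).1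
    obtain ⟨y, hy, rfl⟩ := (hk₀ 0).ball_subset_image
      (mem_ball_iff_norm.mpr (hw₀.trans_le (min_le_left _ _)))
    rw [← dist_eq_norm] at hw
    obtain ⟨-, h₂, h₃⟩ := htrack N _ ht0 htb' y hy hw N le_rfl
    refine ⟨y, ?_, (hk₀ N).injOn h₂ (rball_subset_rball hξδ₀ hz) (h₃.trans hwN)⟩
    refine mem_rball_of_edist_le hL ((hk₀ 0).le_edist _ hy _ (mem_rball_self _ hδ₀))
      (r := θ * r / L) (hw.trans_lt ?_) (by field_simp; rfl)
    rw [div_lt_div_iff₀ hbN hL, hθrb]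
    have h1 : 0 < L ^ 2 * H * ξ := by positivity
    linarith
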